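/- For a real separable Hilbert space $H$ (of finite or infinite dimension), let $\mathcal{FS}(H)$ be the set of bounded selfadjoint Fredholm operators on $H$ with the norm topology, $GL(H)$ the set of invertible bounded operators, $I=[0,1]$, and let $\Omega_H=\Omega(\mathcal{FS}(H),GL(H)\cap\mathcal{FS}(H))$ be the set of norm-continuous paths $L=\{L_\lambda\}_{\lambda\in I}$ in $\mathcal{FS}(H)$ with $L_0,L_1\in GL(H)$. The spectral flow of $L\in\Omega_H$ is defined as follows. For a bounded selfadjoint operator $T$ let $\chi_{[a,b]}(T)$ be its spectral projection for the interval $[a,b]$, and $E(T,[a,b])=\operatorname{im}\chi_{[a,b]}(T)$. Choose a partition $0=\lambda_0<\dots<\lambda_N=1$ and numbers $a_1,\dots,a_N>0$ such that, for each $i$, $[\lambda_{i-1},\lambda_i]\ni\lambda\mapsto\chi_{[-a_i,a_i]}(L_\lambda)$ is a norm-continuous family of finite rank projections. Then $$\operatorname{sfl}(L)=\sum_{i=1}^N\bigl(\dim E(L_{\lambda_i},[0,a_i])-\dim E(L_{\lambda_{i-1}},[0,a_i])\bigr)\in\mathbb{Z}.$$ Such data exist for every $L\in\Omega_H$, and $\operatorname{sfl}(L)$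 does not depend on their choice. **Corollary.** Let $\mu=\mu_H:\Omega_H\to\mathbb{Z}$ be a map that is defined for every real separable Hilbert space $H$ and has the following properties: - $(\mathcal{Z})$ If $L_\lambda\in GL(H)$ for all $\lambda\in I$, then $\mu(L)=0$. - $(\mathcal{A})$ If $H=H_1\oplus H_2$ is an orthogonal sum of closed subspaces and $L\in\Omega_H$ satisfies $L_\lambda(H_i)\subset H_i$ for $i=1,2$ and all $\lambda\in I$, then $\mu(L)=\mu(L|_{H_1})+\mu(L|_{H_2})$. - $(\mathcal{H})$ If $h:I\times I\to\mathcal{FS}(H)$ is continuous and $h(s,0),h(s,1)\in GL(H)$ for all $s\in I$, then $\mu(h(0,\cdot))=\mu(h(1,\cdot))$. - $(\mathcal{M})$ If $H$ is finite-dimensional, then $\mu(L)=\mu_{Morse}(L_0)-\mu_{Morse}(L_1)$ for all $L\in\Omega_H$, where $\mu_{Morse}(T)$ is the number of negative eigenvalues of $T$ counted with multiplicity. Then $\mu(L)=\operatorname{sfl}(L)$ for every real separable Hilbert space $H$ and every $L\in\Omega_H$. -/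

import Mathlib

open TopologicalSpace

universe u

namespace SpectralFlow

section Paths

variable (H : Type u) [NormedAddCommGroup H] [InnerProductSpace ℝ H] [CompleteSpace H]

/-- `FS(H)`: the bounded selfadjoint Fredholm operators on the real Hilbert space `H`. -/
def fredholmSelfAdjoint : Set (H →L[ℝ] H) :=
  {T | IsSelfAdjoint T ∧ T.IsFredholm}

/-- `Ω(FS(H), GL(H) ∩ FS(H))`: norm-continuous paths of selfadjoint Fredholm operators,
parametrised by the unit interval, whose endpoints are invertible. -/
structure FredholmPath where
  toFun : unitInterval → (H →L[ℝ] H)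
  continuous_toFun : Continuous toFun
  mem_fredholmSelfAdjoint : ∀ t, toFun t ∈ fredholmSelfAdjoint H
  isUnit_zero : IsUnit (toFun 0)
  isUnit_one : IsUnit (toFun 1)

instance : CoeFun (FredholmPath H) (fun _ => unitInterval → (H →L[ℝ] H)) :=
  ⟨FredholmPath.toFun⟩

end Paths

section SpectralProjections

variable {H : Type u} [NormedAddCommGroup H] [InnerProductSpace ℝ H]

/-- The spectral subspace `E(T, [a, b]) = im χ_[a,b](T)` of a bounded selfadjoint operator `T`,
as the largest closed `T`-invariant subspace on which `a ≤ T ≤ b` (equivalently, on which the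
restriction of `T` has its spectrum in `[a, b]`).

The image of `χ_[a,b](T)` is such a subspace, and conversely every closed `T`-invariant
subspace `M` is reducing, so that `χ_[a,b](T)` restricts to `χ_[a,b](T|_M)`, which is the identity
of `M` if `a ≤ T|_M ≤ b`. -/
def spectralSubspace (T : H →L[ℝ] H) (a b : ℝ) : Submodule ℝ H :=
  (sSup {M : Submodule ℝ H | (∀ x ∈ M, T x ∈ M) ∧
    ∀ x ∈ M, a * ‖x‖ ^ 2 ≤ inner ℝ (T x) x ∧ inner ℝ (T x) x ≤ b * ‖x‖ ^ 2}).topologicalClosure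

instance instCompleteSpaceSpectralSubspace [CompleteSpace H] (T : H →L[ℝ] H) (a b : ℝ) :
    CompleteSpace (spectralSubspace T a b) :=
  (Submodule.isClosed_topologicalClosure _).completeSpace_coe

/-- The spectral projection `χ_[a,b](T)`: the orthogonal projection onto `E(T, [a, b])`. -/
noncomputable def spectralProjection [CompleteSpace H] (T : H →L[ℝ] H) (a b : ℝ) : H →L[ℝ] H :=
  (spectralSubspace T a b).starProjection

/-- The Morse index of an operator on a finite-dimensional space: the number of negative eigenvalues
counted with multiplicity, i.e. the dimension of the sum of the eigenspaces for them. -/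
noncomputable def morseIndex (T : H →L[ℝ] H) : ℕ :=
  Module.finrank ℝ
    (⨆ c : {c : ℝ // c < 0}, Module.End.eigenspace (T : H →ₗ[ℝ] H) c.1 : Submodule ℝ H)

end SpectralProjections

section Flow

variable {H : Type u} [NormedAddCommGroup H] [InnerProductSpace ℝ H] [CompleteSpace H]

/-- The data from which the spectral flow of a path `L` is computed: a partition
`0 = t 0 < ⋯ < t N = 1` and numbers `a i > 0` such that on the `i`-th closed subinterval
`s ↦ χ_[-a i, a i](L s)` is a norm-continuous family of finite rank projections. -/
structure SpectralPartition (L : unitInterval → (H →L[ℝ] H)) where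
  N : ℕ
  t : Fin (N + 1) → unitInterval
  strictMono_t : StrictMono t
  t_zero : t 0 = 0
  t_last : t (Fin.last N) = 1
  a : Fin N → ℝ
  a_pos : ∀ i, 0 < a i
  finite_rank : ∀ i, ∀ s ∈ Set.Icc (t i.castSucc) (t i.succ),
    FiniteDimensional ℝ (spectralSubspace (L s) (-a i) (a i))
  continuousOn_projection : ∀ i,
    ContinuousOn (fun s => spectralProjection (L s) (-a i) (a i))
      (Set.Icc (t i.castSucc) (t i.succ))

/-- `∑ i, (dim E(L (t i), [0, a i]) - dim E(L (t (i - 1)), [0, a i]))`. -/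
noncomputable def SpectralPartition.value {L : unitInterval → (H →L[ℝ] H)}
    (D : SpectralPartition L) : ℤ :=
  ∑ i : Fin D.N,
    ((Module.finrank ℝ (spectralSubspace (L (D.t i.succ)) 0 (D.a i)) : ℤ) -
      (Module.finrank ℝ (spectralSubspace (L (D.t i.castSucc)) 0 (D.a i)) : ℤ))

open Classical in
/-- The spectral flow `sfl(L)`, computed from some choice of partition data. The value `0` is used
if there are no such data. -/
noncomputable def spectralFlow (L : unitInterval → (H →L[ℝ] H)) : ℤ :=
  if h : Nonempty (SpectralPartition L) then h.some.value else 0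

end Flow

section Properties

/-- A family of maps `μ_H : Ω(FS(H), GL(H) ∩ FS(H)) → ℤ`, one for every real separable Hilbert
space `H`. -/
abbrev PathInvariant : Type (u + 1) :=
  ∀ (H : Type u) [NormedAddCommGroup H] [InnerProductSpace ℝ H] [CompleteSpace H]
    [SeparableSpace H], FredholmPath H → ℤ

/-- `(Z)`: paths of invertible operators are mapped to `0`. -/
def ZeroProperty (μ : PathInvariant.{u}) : Prop :=
  ∀ (H : Type u) [NormedAddCommGroup H] [InnerProductSpace ℝ H] [CompleteSpace H]
    [SeparableSpace H] (L : FredholmPath H), (∀ t, IsUnit (L t)) → μ H L = 0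

instance instSeparableSpaceSubmodule {H : Type u} [NormedAddCommGroup H] [InnerProductSpace ℝ H]
    [SeparableSpace H] (K : Submodule ℝ H) : SeparableSpace K :=
  (IsSeparable.of_separableSpace (K : Set H)).separableSpace

/-- `(A)`: additivity. Here `H = H₁ ⊕ H₂` is an orthogonal decomposition into closed subspaces,
and `L₁`, `L₂` are the restrictions of `L` to `H₁`, `H₂`. -/
def AdditivityProperty (μ : PathInvariant.{u}) : Prop :=
  ∀ (H : Type u) [NormedAddCommGroup H] [InnerProductSpace ℝ H] [CompleteSpace H]
    [SeparableSpace H] (H₁ H₂ : Submodule ℝ H) [CompleteSpace H₁] [CompleteSpace H₂],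
    IsCompl H₁ H₂ → H₁ ⟂ H₂ →
    ∀ (L : FredholmPath H) (L₁ : FredholmPath H₁) (L₂ : FredholmPath H₂),
      (∀ t (x : H₁), (L₁ t x : H) = L t x) → (∀ t (x : H₂), (L₂ t x : H) = L t x) →
      μ H L = μ H₁ L₁ + μ H₂ L₂

/-- `(H)`: invariance under homotopies in `FS(H)` through paths with invertible endpoints. -/
def HomotopyProperty (μ : PathInvariant.{u}) : Prop :=
  ∀ (H : Type u) [NormedAddCommGroup H] [InnerProductSpace ℝ H] [CompleteSpace H]
    [SeparableSpace H] (h : unitInterval × unitInterval → (H →L[ℝ] H)),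
    Continuous h → (∀ p, h p ∈ fredholmSelfAdjoint H) →
    (∀ s, IsUnit (h (s, 0)) ∧ IsUnit (h (s, 1))) →
    ∀ L₀ L₁ : FredholmPath H, (∀ t, L₀ t = h (0, t)) → (∀ t, L₁ t = h (1, t)) → μ H L₀ = μ H L₁

/-- `(M)`: on finite-dimensional spaces, `μ` is the difference of the Morse indices. -/
def MorseProperty (μ : PathInvariant.{u}) : Prop :=
  ∀ (H : Type u) [NormedAddCommGroup H] [InnerProductSpace ℝ H] [CompleteSpace H]
    [SeparableSpace H] [FiniteDimensional ℝ H] (L : FredholmPath H),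
    μ H L = (morseIndex (L 0) : ℤ) - (morseIndex (L 1) : ℤ)

end Properties

end SpectralFlow

set_option linter.unusedSectionVars false

namespace SpectralFlow

open Topology unitInterval

/-! ### Selfadjoint Fredholm operators and finite-rank perturbations -/

section Fredholm

variable {H : Type u} [NormedAddCommGroup H] [InnerProductSpace ℝ H] [CompleteSpace H]

/-! The value of every admissible partition is shown to equal `μ H L`. Independence of the choices
then follows from the existence of `μ`, and only the existence of a partition needs a separate
argument.

Additivity under concatenation is not an axiom and has to be derived. Near a selfadjoint Fredholm
operator `T₀`, every selfadjoint `T` is congruent, continuously in `T`, to `T₀` plus a perturbation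
with values in `ker T₀` (`exists_local_congruence`). Gluing makes the whole path congruent to
perturbations of `L 0` with values in one finite-dimensional space
(`exists_congruence_finite_rank`). That space can be enlarged until the complementary block of `L 0`
is invertible. This block is then constant along the path, and block elimination splits off an
invertible part. By additivity, the zero property and the Morse property, `μ` is a difference of
Morse indices of Schur complements. One space serves all subintervals, so `μ` on `[c, d]` has the
form `m c - m d` (`exists_relative_index`) and telescopes over a partition.

On one piece of the partition, parallel transport makes the spectral projection constant, and `μ` is
the difference of the Morse indices of the compressions (`invariant_eq_of_projections`). Operators
at the partition points may be singular, so the path is first shifted by a small `ε > 0`. On `E(T,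
[-a, a])` the Morse index of `T + ε` is `dim E(T, [-a, a]) - dim E(T, [0, a])`
(`eventually_morseIndex_eq`); the first terms cancel between the two ends, which leaves the summand
in the spectral flow.

Partitions exist because the kernel of `T₀` deforms to invariant subspaces of nearby operators, by a
Riccati equation, and a spectral gap identifies these with spectral subspaces
(`exists_continuous_spectralProjection`). -/

theorem inner_selfAdjoint {T : H →L[ℝ] H} (hT : IsSelfAdjoint T) (x y : H) :
    inner ℝ (T x) y = inner ℝ x (T y) :=
  hT.isSymmetric x y

theorem range_eq_orthogonal_ker {T : H →L[ℝ] H} (hT : T ∈ fredholmSelfAdjoint H) :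
    T.range = T.kerᗮ := by
  rw [T.orthogonal_ker, ← ContinuousLinearMap.star_eq_adjoint, hT.1.star_eq,
    hT.2.isClosed_range.submodule_topologicalClosure_eq]

theorem isUnit_of_injective {T : H →L[ℝ] H} (hT : T ∈ fredholmSelfAdjoint H)
    (h : ∀ x, T x = 0 → x = 0) : IsUnit T := by
  have hker : T.ker = ⊥ := (Submodule.eq_bot_iff _).2 fun x hx => h x hx
  rw [ContinuousLinearMap.isUnit_iff_bijective]
  refine ⟨(injective_iff_map_eq_zero T).2 h, ?_⟩
  have := range_eq_orthogonal_ker hT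
  rw [hker, Submodule.bot_orthogonal_eq_top] at this
  exact LinearMap.range_eq_top.1 this

theorem injective_of_isUnit {T : H →L[ℝ] H} (h : IsUnit T) {x : H} (hx : T x = 0) : x = 0 :=
  (injective_iff_map_eq_zero T).1 (ContinuousLinearMap.isUnit_iff_bijective.1 h).1 x hx

/-- The inverse of `T + K` inverts `T` modulo finite-rank operators. Being invertible after a
finite-rank correction is the working form of the Fredholm property below. -/
theorem isFredholm_of_isUnit_add {T K : H →L[ℝ] H} (hK : (K : H →ₗ[ℝ] H).HasFiniteRange)
    (h : IsUnit (T + K)) : T.IsFredholm := by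
  obtain ⟨v, hv⟩ := h
  refine ContinuousLinearMap.IsFredholm.of_isQuasiInverse (v := (↑v⁻¹ : H →L[ℝ] H)) ⟨?_, ?_⟩
  · refine LinearMap.FiniteRangeSetoid.equiv_iff_hasFiniteRange.2 ?_
    have h1 : (↑v⁻¹ : H →L[ℝ] H) * T - 1 = -((↑v⁻¹ : H →L[ℝ] H) * K) := by
      have : (↑v⁻¹ : H →L[ℝ] H) * (T + K) = 1 := by rw [← hv]; exact v.inv_mul
      rw [mul_add] at this
      rw [← this]; abel
    have h2 := (hK.comp_left ((↑v⁻¹ : H →L[ℝ] H) : H →ₗ[ℝ] H)).neg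
    exact (congrArg (fun A : H →L[ℝ] H => (A : H →ₗ[ℝ] H).HasFiniteRange) h1).mpr h2
  · refine LinearMap.FiniteRangeSetoid.equiv_iff_hasFiniteRange.2 ?_
    have h1 : T * (↑v⁻¹ : H →L[ℝ] H) - 1 = -(K * (↑v⁻¹ : H →L[ℝ] H)) := by
      have : (T + K) * (↑v⁻¹ : H →L[ℝ] H) = 1 := by rw [← hv]; exact v.mul_inv
      rw [add_mul] at this
      rw [← this]; abel
    have h2 := (hK.comp_right ((↑v⁻¹ : H →L[ℝ] H) : H →ₗ[ℝ] H)).neg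
    exact (congrArg (fun A : H →L[ℝ] H => (A : H →ₗ[ℝ] H).HasFiniteRange) h1).mpr h2

theorem starProjection_hasFiniteRange (E : Submodule ℝ H) [FiniteDimensional ℝ E] :
    (E.starProjection : H →ₗ[ℝ] H).HasFiniteRange := by
  have : (E.starProjection : H →ₗ[ℝ] H).range = E := Submodule.range_starProjection E
  rw [LinearMap.hasFiniteRange_iff_range, this]
  exact Submodule.FG.of_finite

theorem isUnit_add_starProjection_ker {T : H →L[ℝ] H} (hT : T ∈ fredholmSelfAdjoint H)
    [FiniteDimensional ℝ T.ker] : IsUnit (T + T.ker.starProjection) := by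
  have hr := range_eq_orthogonal_ker hT
  rw [ContinuousLinearMap.isUnit_iff_bijective]
  constructor
  · refine (injective_iff_map_eq_zero _).2 fun x hx => ?_
    have h1 : T x ∈ T.kerᗮ := hr ▸ ⟨x, rfl⟩
    have h2 : T x = - T.ker.starProjection x := eq_neg_of_add_eq_zero_left hx
    have h3 : T x ∈ T.ker := h2 ▸ T.ker.neg_mem (Submodule.starProjection_apply_mem _ _)
    have h4 : T x = 0 := by
      have := Submodule.inner_right_of_mem_orthogonal h3 h1
      simpa using this
    have h5 : T.ker.starProjection x = 0 := by rw [h4] at h2; simpa using h2.symm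
    rwa [Submodule.starProjection_eq_self_iff.2 h4] at h5
  · intro y
    have hy : y - T.ker.starProjection y ∈ T.range := by
      rw [hr]; exact Submodule.sub_starProjection_mem_orthogonal y
    obtain ⟨z, hz⟩ := hy
    have hz' : T z = y - T.ker.starProjection y := hz
    have e1 : T (T.ker.starProjection z) = 0 := Submodule.starProjection_apply_mem T.ker z
    have e2 : T (T.ker.starProjection y) = 0 := Submodule.starProjection_apply_mem T.ker y
    have e3 : ∀ w, T.ker.starProjection (T.ker.starProjection w) = T.ker.starProjection w :=
      fun w => Submodule.starProjection_eq_self_iff.2 (Submodule.starProjection_apply_mem _ _)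
    -- Changing the kernel component of `z` does not affect `T z`, so it is replaced by that of `y`.
    refine ⟨z - T.ker.starProjection z + T.ker.starProjection y, ?_⟩
    simp only [add_apply, map_add, map_sub, e1, e2, e3, hz']
    abel

theorem exists_isUnit_add {T : H →L[ℝ] H} (hT : T ∈ fredholmSelfAdjoint H) :
    ∃ K : H →L[ℝ] H, (K : H →ₗ[ℝ] H).HasFiniteRange ∧ IsUnit (T + K) := by
  have := hT.2.finite_ker
  exact ⟨_, starProjection_hasFiniteRange _, isUnit_add_starProjection_ker hT⟩

theorem mem_fredholmSelfAdjoint_of_isUnit {T : H →L[ℝ] H} (hT : IsSelfAdjoint T) (h : IsUnit T) :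
    T ∈ fredholmSelfAdjoint H :=
  ⟨hT, isFredholm_of_isUnit_add (K := 0) LinearMap.HasFiniteRange.zero (by simpa using h)⟩

theorem mem_fredholmSelfAdjoint_of_finiteDimensional [FiniteDimensional ℝ H] {T : H →L[ℝ] H}
    (hT : IsSelfAdjoint T) : T ∈ fredholmSelfAdjoint H :=
  ⟨hT, isFredholm_of_isUnit_add (K := 1 - T) LinearMap.HasFiniteRange.of_finite_dom (by simp)⟩

theorem isSelfAdjoint_congruence {T : H →L[ℝ] H} (hT : IsSelfAdjoint T) (G : H →L[ℝ] H) :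
    IsSelfAdjoint (star G * T * G) := by
  simpa using hT.conjugate' G

theorem congruence_mem_fredholmSelfAdjoint {T G : H →L[ℝ] H} (hT : T ∈ fredholmSelfAdjoint H)
    (hG : IsUnit G) : star G * T * G ∈ fredholmSelfAdjoint H := by
  refine ⟨isSelfAdjoint_congruence hT.1 G, ?_⟩
  obtain ⟨K, hK, hu⟩ := exists_isUnit_add hT
  refine isFredholm_of_isUnit_add (K := star G * K * G) ?_ ?_
  · exact (hK.comp_left (star G : H →L[ℝ] H).toLinearMap).comp_right G.toLinearMap
  · rw [← add_mul, ← mul_add]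
    exact (hG.star.mul hu).mul hG

theorem add_mem_fredholmSelfAdjoint {T K : H →L[ℝ] H} (hT : T ∈ fredholmSelfAdjoint H)
    (hKs : IsSelfAdjoint K) (hK : (K : H →ₗ[ℝ] H).HasFiniteRange) :
    T + K ∈ fredholmSelfAdjoint H := by
  refine ⟨hT.1.add hKs, ?_⟩
  obtain ⟨K', hK', hu⟩ := exists_isUnit_add hT
  refine isFredholm_of_isUnit_add (K := K' - K) ?_ (by convert hu using 1; abel)
  exact hK'.sub hK

theorem exists_pos_isUnit_add {X : Type*} [TopologicalSpace X] {s : Set X} (hs : IsCompact s)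
    {f : X → H →L[ℝ] H} (hf : ContinuousOn f s) (hu : ∀ x ∈ s, IsUnit (f x)) :
    ∃ ε > 0, ∀ x ∈ s, ∀ D : H →L[ℝ] H, ‖D‖ < ε → IsUnit (f x + D) := by
  obtain ⟨ε, hε, h⟩ := (hs.image_of_continuousOn hf).exists_thickening_subset_open
    (Units.isOpen (R := H →L[ℝ] H)) (by rintro _ ⟨x, hx, rfl⟩; exact hu x hx)
  refine ⟨ε, hε, fun x hx D hD => h ?_⟩
  rw [Metric.mem_thickening_iff]
  exact ⟨f x, ⟨x, hx, rfl⟩, by simpa [dist_eq_norm] using hD⟩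

theorem exists_pos_add_mem_fredholmSelfAdjoint {X : Type*} [TopologicalSpace X] [CompactSpace X]
    {f : X → H →L[ℝ] H} (hf : Continuous f) (hu : ∀ x, f x ∈ fredholmSelfAdjoint H) :
    ∃ ε > 0, ∀ x, ∀ D : H →L[ℝ] H, IsSelfAdjoint D → ‖D‖ < ε →
      f x + D ∈ fredholmSelfAdjoint H := by
  -- For each fixed correction `K` the condition is open, so the union over all `K` is open.
  have ho : IsOpen {T : H →L[ℝ] H | ∃ K : H →L[ℝ] H, (K : H →ₗ[ℝ] H).HasFiniteRange ∧
      IsUnit (T + K)} := by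
    simp only [Set.ofPred_exists, Set.ofPred_and]
    refine isOpen_iUnion fun K => isOpen_const.inter ?_
    exact (Units.isOpen (R := H →L[ℝ] H)).preimage (by fun_prop : Continuous fun T => T + K)
  obtain ⟨ε, hε, h⟩ := (isCompact_range hf).exists_thickening_subset_open ho
    (by rintro _ ⟨x, rfl⟩; exact exists_isUnit_add (hu x))
  refine ⟨ε, hε, fun x D hD hn => ⟨(hu x).1.add hD, ?_⟩⟩
  obtain ⟨K, hK, hk⟩ := h (Metric.mem_thickening_iff.2
    ⟨f x, ⟨x, rfl⟩, (by simpa [dist_eq_norm] using hn : dist (f x + D) (f x) < ε)⟩)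
  exact isFredholm_of_isUnit_add hK hk

theorem exists_pos_norm_le {T : H →L[ℝ] H} (hT : IsUnit T) :
    ∃ c > 0, ∀ x, c * ‖x‖ ≤ ‖T x‖ := by
  obtain ⟨v, rfl⟩ := hT
  refine ⟨(‖(↑v⁻¹ : H →L[ℝ] H)‖ + 1)⁻¹, by positivity, fun x => ?_⟩
  have h1 : (↑v⁻¹ : H →L[ℝ] H) ((v : H →L[ℝ] H) x) = x := by
    rw [← mul_apply_eq_comp, v.inv_mul]; rfl
  have h2 := (↑v⁻¹ : H →L[ℝ] H).le_opNorm ((v : H →L[ℝ] H) x)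
  rw [h1] at h2
  rw [inv_mul_le_iff₀ (by positivity)]
  nlinarith [norm_nonneg ((v : H →L[ℝ] H) x)]

theorem norm_smul_one_le (ε : ℝ) : ‖ε • (1 : H →L[ℝ] H)‖ ≤ |ε| := by
  rw [norm_smul, Real.norm_eq_abs]
  exact mul_le_of_le_one_right (abs_nonneg _) ContinuousLinearMap.norm_id_le

/-- A kernel vector of `T + ε` lies in the range of `T`, that is in `T.kerᗮ`, where `T` is bounded
below by some `c`; this is impossible for `0 < ε < c` unless the vector is zero. -/
theorem exists_pos_isUnit_add_smul_one {T : H →L[ℝ] H} (hT : T ∈ fredholmSelfAdjoint H) :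
    ∃ ε₀ > 0, ∀ ε : ℝ, 0 < ε → ε < ε₀ → IsUnit (T + ε • (1 : H →L[ℝ] H)) := by
  have := hT.2.finite_ker
  obtain ⟨c, hc, hcb⟩ := exists_pos_norm_le (isUnit_add_starProjection_ker hT)
  obtain ⟨δ, hδ, hF⟩ := exists_pos_add_mem_fredholmSelfAdjoint (X := Unit) (f := fun _ => T)
    continuous_const (fun _ => hT)
  refine ⟨min c (δ / 2), by positivity, fun ε h0 h1 => ?_⟩
  have hn : ‖ε • (1 : H →L[ℝ] H)‖ < δ := by
    refine (norm_smul_one_le ε).trans_lt ?_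
    rw [abs_of_pos h0]
    linarith [min_le_right c (δ / 2)]
  refine isUnit_of_injective
    (hF () _ (IsSelfAdjoint.smul (IsSelfAdjoint.all ε) (IsSelfAdjoint.one _)) hn) fun x hx => ?_
  have hx1 : T x = -(ε • x) := eq_neg_of_add_eq_zero_left (by simpa using hx)
  have hx2 : x ∈ T.kerᗮ := by
    rw [← range_eq_orthogonal_ker hT]
    exact ⟨-(ε⁻¹ • x), by simp [hx1, smul_smul, h0.ne']⟩
  have hx3 : T.ker.starProjection x = 0 :=
    (Submodule.starProjection_apply_eq_zero_iff _).2 hx2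
  have h4 := hcb x
  rw [add_apply, hx3, add_zero, hx1, norm_neg, norm_smul,
    Real.norm_of_nonneg h0.le] at h4
  by_contra hne
  have : 0 < ‖x‖ := norm_pos_iff.2 hne
  have h5 : ε < c := lt_of_lt_of_le h1 (min_le_left _ _)
  nlinarith

end Fredholm

/-! ### Block elimination and the Schur complement -/

section Schur

variable {R : Type*} [Ring R]

/-- The compression of `T` to the range of `1 - P`, extended by the identity on the range
of `P`. -/
def complCompression (P T : R) : R := (1 - P) * T * (1 - P) + P

/-- The off-diagonal part of the block elimination that decouples the ranges of `P` and
`1 - P`. -/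
noncomputable def eliminator (P T : R) : R :=
  (1 - P) * Ring.inverse (complCompression P T) * T * P

variable {P T : R}

theorem eliminator_mul_self (hP : P * P = P) : eliminator P T * eliminator P T = 0 := by
  unfold eliminator
  generalize Ring.inverse (complCompression P T) = r
  linear_combination (norm := noncomm_ring) -((1 - P) * r * T * hP * r * T * P)

theorem eliminator_mul (hP : P * P = P) : eliminator P T * (1 - P) = 0 := by
  unfold eliminator
  generalize Ring.inverse (complCompression P T) = r
  linear_combination (norm := noncomm_ring) -((1 - P) * r * T * hP)

theorem mul_inverse_complCompression (hP : P * P = P) (hu : IsUnit (complCompression P T)) :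
    P * Ring.inverse (complCompression P T) = P := by
  have h : P * complCompression P T = P := by
    unfold complCompression
    linear_combination (norm := noncomm_ring) hP - hP * T * (1 - P)
  calc P * Ring.inverse (complCompression P T)
      = P * complCompression P T * Ring.inverse (complCompression P T) := by rw [h]
    _ = P := by rw [mul_assoc, Ring.mul_inverse_cancel _ hu, mul_one]

/-- The eliminator solves `(1 - P) T (1 - P) X = (1 - P) T P`, which is what cancels the
off-diagonal block. -/
theorem compl_mul_mul_eliminate (hP : P * P = P) (hu : IsUnit (complCompression P T)) :
    (1 - P) * T * (1 - eliminator P T) * P = 0 := by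
  have h1 := mul_inverse_complCompression hP hu
  have h2 := Ring.mul_inverse_cancel _ hu
  unfold eliminator
  generalize Ring.inverse (complCompression P T) = r at *
  unfold complCompression at h2
  linear_combination (norm := noncomm_ring)
    -((1 - P) * T * hP) - h2 * (T * P * P) + h1 * (T * P * P)

/-- The eliminator squares to zero, so the inverse is `1 + r • eliminator P T`. The free factor `r`
gives a path of congruences from the identity to the elimination. -/
theorem isUnit_one_sub_smul_eliminator [Algebra ℝ R] (hP : P * P = P) (r : ℝ) :
    IsUnit (1 - r • eliminator P T) := by
  have h := eliminator_mul_self (T := T) hP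
  refine isUnit_iff_exists.2 ⟨1 + r • eliminator P T, ?_, ?_⟩
  · simp [mul_add, sub_mul, h]
  · simp [mul_sub, add_mul, h]

variable [StarRing R]

/-- The operator `T` after block elimination. -/
noncomputable def eliminate (P T : R) : R :=
  star (1 - eliminator P T) * T * (1 - eliminator P T)

theorem compl_mul_star_one_sub_eliminator (hP : IsStarProjection P) :
    (1 - P) * star (1 - eliminator P T) = 1 - P := by
  have h : (1 - eliminator P T) * (1 - P) = 1 - P := by
    rw [sub_mul, eliminator_mul hP.isIdempotentElem.eq]; simp
  simpa [hP.isSelfAdjoint.star_eq] using congrArg star h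

theorem compl_mul_eliminate (hP : IsStarProjection P) (hu : IsUnit (complCompression P T)) :
    (1 - P) * eliminate P T = complCompression P T - P := by
  have hi := hP.isIdempotentElem.eq
  have h1 := compl_mul_star_one_sub_eliminator (T := T) hP
  have h2 := compl_mul_mul_eliminate hi hu
  have h3 := eliminator_mul (T := T) hi
  unfold eliminate
  rw [← mul_assoc, ← mul_assoc, h1]
  unfold complCompression
  linear_combination (norm := noncomm_ring) h2 - (1 - P) * T * h3

theorem compl_mul_eliminate_mul (hP : IsStarProjection P) (hu : IsUnit (complCompression P T)) :
    (1 - P) * eliminate P T * P = 0 := by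
  rw [compl_mul_eliminate hP hu]
  unfold complCompression
  linear_combination (norm := noncomm_ring) -((1 - P) * T * hP.isIdempotentElem.eq)

theorem complCompression_eliminate (hP : IsStarProjection P)
    (hu : IsUnit (complCompression P T)) :
    complCompression P (eliminate P T) = complCompression P T := by
  have h := compl_mul_eliminate hP hu
  rw [complCompression, h]
  unfold complCompression
  linear_combination (norm := noncomm_ring) ((1 - P) * T) * hP.isIdempotentElem.eq

end Schur

/-! ### Inversion and a quadratic equation in Banach algebras -/

section BanachAlgebra

variable {R : Type*} [NormedRing R] [CompleteSpace R]

theorem continuousAt_inverse {x : R} (h : IsUnit x) : ContinuousAt Ring.inverse x := by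
  obtain ⟨v, rfl⟩ := h
  exact NormedRing.inverse_continuousAt v

theorem continuous_complCompression (P : R) : Continuous (complCompression P : R → R) := by
  unfold complCompression; fun_prop

theorem continuousAt_eliminator {P T : R} (h : IsUnit (complCompression P T)) :
    ContinuousAt (eliminator P) T := by
  have h1 : ContinuousAt (fun T => Ring.inverse (complCompression P T)) T :=
    ContinuousAt.comp (g := Ring.inverse) (continuousAt_inverse h)
      (continuous_complCompression P).continuousAt
  exact (((continuousAt_const.mul h1).mul continuousAt_id).mul continuousAt_const)

/-- Inverse function theorem at `0`, where the derivative is multiplication by `2`. For selfadjoint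
`y` and invertible selfadjoint `S`, the equation says that the congruence by `1 + S y` carries `S⁻¹`
to `S⁻¹ + D`. -/
theorem exists_local_solution [NormedAlgebra ℝ R] (S : R) (δ : ℝ) (hδ : 0 < δ) :
    ∃ U : Set R, IsOpen U ∧ (0 : R) ∈ U ∧ ∃ y : R → R, ContinuousOn y U ∧
      ∀ D ∈ U, (2 : ℝ) • y D + y D * S * y D = D ∧ ‖y D‖ < δ := by
  have h1 : HasStrictFDerivAt (fun Y : R => Y) (ContinuousLinearMap.id ℝ R) 0 :=
    hasStrictFDerivAt_id 0
  have h2 : HasStrictFDerivAt (fun Y : R => (2 : ℝ) • Y + Y * S * Y)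
      ((ContinuousLinearEquiv.smulLeft (Units.mk0 (2 : ℝ) two_ne_zero) : R ≃L[ℝ] R) :
        R →L[ℝ] R) 0 := by
    refine ((h1.const_smul (2 : ℝ)).add ((h1.mul_const' S).mul' h1)).congr_fderiv ?_
    ext y
    simp [Units.smul_def]
  set e := h2.toOpenPartialHomeomorph _ with he
  have h0 : (0 : R) ∈ e.target := by
    simpa using h2.image_mem_toOpenPartialHomeomorph_target
  have hs0 : e.symm 0 = 0 := by
    have := e.left_inv h2.mem_toOpenPartialHomeomorph_source
    simpa [he] using this
  refine ⟨e.target ∩ e.symm ⁻¹' Metric.ball 0 δ,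
    e.symm.isOpen_inter_preimage Metric.isOpen_ball, ⟨h0, by simpa [hs0] using hδ⟩, e.symm,
    e.continuousOn_symm.mono Set.inter_subset_left, fun D hD => ⟨?_, by simpa using hD.2⟩⟩
  exact e.right_inv hD.1

theorem solution_unique [NormedAlgebra ℝ R] {S y y' : R}
    (h : (2 : ℝ) • y + y * S * y = (2 : ℝ) • y' + y' * S * y')
    (hy : ‖y‖ * ‖S‖ < 1) (hy' : ‖S‖ * ‖y'‖ < 1) : y = y' := by
  have h1 : (2 : ℝ) • (y - y') = -(y * S * (y - y') + (y - y') * S * y') := by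
    rw [smul_sub]
    have : (2 : ℝ) • y - (2 : ℝ) • y' = y' * S * y' - y * S * y := by
      rw [sub_eq_sub_iff_add_eq_add, h]; abel
    rw [this]; noncomm_ring
  have h2 : 2 * ‖y - y'‖ ≤ ‖y‖ * ‖S‖ * ‖y - y'‖ + ‖y - y'‖ * (‖S‖ * ‖y'‖) := by
    calc 2 * ‖y - y'‖ = ‖(2 : ℝ) • (y - y')‖ := by rw [norm_smul]; norm_num
      _ ≤ ‖y * S * (y - y')‖ + ‖(y - y') * S * y'‖ := by
        rw [h1, norm_neg]; exact norm_add_le _ _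
      _ ≤ _ := by
        gcongr
        · exact (norm_mul_le _ _).trans (by gcongr; exact norm_mul_le _ _)
        · rw [mul_assoc]; exact (norm_mul_le _ _).trans (by gcongr; exact norm_mul_le _ _)
  by_contra hne
  have : 0 < ‖y - y'‖ := norm_pos_iff.2 (sub_ne_zero.2 hne)
  nlinarith

theorem isUnit_one_add_of_norm_lt_one {x : R} (h : ‖x‖ < 1) : IsUnit (1 + x) := by
  have := isUnit_one_sub_of_norm_lt_one (x := -x) (by simpa using h)
  simpa using this

end BanachAlgebra

/-! ### Local congruence modulo the kernel -/

section LocalCongruence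

variable {H : Type u} [NormedAddCommGroup H] [InnerProductSpace ℝ H] [CompleteSpace H]

theorem norm_star_eq (T : H →L[ℝ] H) : ‖star T‖ = ‖T‖ :=
  ContinuousLinearMap.adjoint.norm_map T

/-- With `Q` the projection onto `ker T₀`, elimination decouples `T`, and the complementary block,
completed by `Q`, is `T₀ + Q + D` with `D` small. The quadratic equation removes `D` by a further
congruence that respects the splitting, so only a block on `ker T₀` differs from `T₀`. -/
theorem exists_local_congruence {T₀ : H →L[ℝ] H} (hT₀ : T₀ ∈ fredholmSelfAdjoint H) :
    ∃ E : Submodule ℝ H, FiniteDimensional ℝ E ∧ ∃ U : Set (H →L[ℝ] H), IsOpen U ∧ T₀ ∈ U ∧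
      ∃ Γ : (H →L[ℝ] H) → (H →L[ℝ] H), ContinuousOn Γ U ∧
        ∀ T ∈ U, IsUnit (Γ T) ∧
          (IsSelfAdjoint T → ∀ x, (star (Γ T) * T * Γ T - T₀) x ∈ E) := by
  have hfin := hT₀.2.finite_ker
  set Q : H →L[ℝ] H := T₀.ker.starProjection with hQdef
  have hQ : IsStarProjection Q := isStarProjection_starProjection
  have hQi := hQ.isIdempotentElem.eq
  have hT₀Q : T₀ * Q = 0 := by
    ext x
    exact Submodule.starProjection_apply_mem T₀.ker x
  have hQT₀ : Q * T₀ = 0 := by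
    simpa [hQ.isSelfAdjoint.star_eq, hT₀.1.star_eq] using congrArg star hT₀Q
  have hS := isUnit_add_starProjection_ker hT₀
  rw [← hQdef] at hS
  have hS₀ : complCompression Q T₀ = T₀ + Q := by
    unfold complCompression
    linear_combination (norm := noncomm_ring) Q * hT₀Q - hQT₀ - hT₀Q
  obtain ⟨v, hv⟩ := hS
  set s : H →L[ℝ] H := ↑v⁻¹ with hs
  have hvs : (T₀ + Q) * s = 1 := by rw [← hv]; exact v.mul_inv
  have hsv : s * (T₀ + Q) = 1 := by rw [← hv]; exact v.inv_mul
  have hssa : star s = s := by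
    have h1 : star s * (T₀ + Q) = 1 := by
      simpa [hQ.isSelfAdjoint.star_eq, hT₀.1.star_eq] using congrArg star hvs
    calc star s = star s * ((T₀ + Q) * s) := by rw [hvs, mul_one]
      _ = s := by rw [← mul_assoc, h1, one_mul]
  have hQs : Q * s = Q := by
    have : Q * (T₀ + Q) = Q := by rw [mul_add, hQT₀, hQi, zero_add]
    calc Q * s = Q * (T₀ + Q) * s := by rw [this]
      _ = Q := by rw [mul_assoc, hvs, mul_one]
  -- This bound gives `‖y D‖ * ‖s‖ < 1`, hence both invertibility of `1 + s * y D` and uniqueness of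
  -- the small solution.
  obtain ⟨V, hVo, hV0, y, hyc, hy⟩ :=
    exists_local_solution s (‖s‖ + 1)⁻¹ (by positivity)
  have hV' : IsOpen {T : H →L[ℝ] H | IsUnit (complCompression Q T)} :=
    (Units.isOpen (R := H →L[ℝ] H)).preimage (continuous_complCompression Q)
  have hDc : Continuous fun T : H →L[ℝ] H => complCompression Q T - (T₀ + Q) :=
    (continuous_complCompression Q).sub continuous_const
  have hsmall : ∀ D ∈ V, ‖y D‖ * ‖s‖ < 1 := by
    intro D hD
    have h2 : ‖y D‖ * (‖s‖ + 1) < 1 := by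
      have := (hy D hD).2
      rwa [← one_div, lt_div_iff₀ (by positivity)] at this
    nlinarith [norm_nonneg (y D)]
  have hX : ∀ D ∈ V, IsUnit (1 + s * y D) := fun D hD =>
    isUnit_one_add_of_norm_lt_one
      ((norm_mul_le _ _).trans_lt (by rw [mul_comm]; exact hsmall D hD))
  refine ⟨T₀.ker, hfin, {T | IsUnit (complCompression Q T)} ∩
    (fun T => complCompression Q T - (T₀ + Q)) ⁻¹' V, hV'.inter (hVo.preimage hDc), ?_,
    fun T => (1 - eliminator Q T) *
      Ring.inverse (1 + s * y (complCompression Q T - (T₀ + Q))), ?_, ?_⟩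
  · refine ⟨?_, ?_⟩
    · change IsUnit (complCompression Q T₀)
      rw [hS₀, ← hv]; exact v.isUnit
    · change complCompression Q T₀ - (T₀ + Q) ∈ V
      rwa [hS₀, sub_self]
  · intro T hT
    refine ContinuousWithinAt.mul ?_ ?_
    · exact (continuousAt_const.sub (continuousAt_eliminator hT.1)).continuousWithinAt
    · have h1 : ContinuousWithinAt (fun T => 1 + s * y (complCompression Q T - (T₀ + Q)))
          ({T | IsUnit (complCompression Q T)} ∩
            (fun T => complCompression Q T - (T₀ + Q)) ⁻¹' V) T := by
        refine continuousWithinAt_const.add (continuousWithinAt_const.mul ?_)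
        exact (hyc _ hT.2).comp (t := V) hDc.continuousWithinAt fun T' hT' => hT'.2
      exact ContinuousAt.comp_continuousWithinAt (g := Ring.inverse)
        (continuousAt_inverse (hX _ hT.2)) h1
  · rintro T ⟨hu, hTV⟩
    change complCompression Q T - (T₀ + Q) ∈ V at hTV
    have hXu := hX _ hTV
    set D := complCompression Q T - (T₀ + Q) with hD
    have hYu : IsUnit (1 - eliminator Q T) := by
      simpa using isUnit_one_sub_smul_eliminator (T := T) hQi 1
    refine ⟨hYu.mul hXu.ringInverse, fun hTsa => ?_⟩
    have hyeq := (hy D hTV).1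
    have hyn := hsmall D hTV
    set z := y D with hz
    have hDsa : star D = D := by
      simp [hD, complCompression, hQ.isSelfAdjoint.star_eq, hT₀.1.star_eq, hTsa.star_eq, mul_assoc]
    -- Since `D` and `s` are selfadjoint, `star z` is a second small solution.
    have hzsa : star z = z := by
      refine solution_unique (S := s) ?_ (by rwa [norm_star_eq]) (by rwa [mul_comm])
      rw [hyeq, ← hDsa, ← hyeq]
      simp [hssa, mul_assoc]
    have hDQ : D * Q = 0 := by
      rw [hD]; unfold complCompression
      linear_combination (norm := noncomm_ring) -((1 - Q) * T * hQi) - hT₀Q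
    -- As `D * Q = 0`, the equation reads `2 z Q = -(z s) (z Q)`, and `z s` has norm less than `1`.
    have hzQ : z * Q = 0 := by
      have h1 : (2 : ℝ) • (z * Q) + z * s * (z * Q) = 0 := by
        rw [← hDQ, ← hyeq, add_mul, smul_mul_assoc, mul_assoc (z * s)]
      have h2 : 2 * ‖z * Q‖ ≤ ‖z‖ * ‖s‖ * ‖z * Q‖ := by
        calc 2 * ‖z * Q‖ = ‖(2 : ℝ) • (z * Q)‖ := by rw [norm_smul]; norm_num
          _ = ‖z * s * (z * Q)‖ := by rw [eq_neg_of_add_eq_zero_left h1, norm_neg]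
          _ ≤ _ := (norm_mul_le _ _).trans (by gcongr; exact norm_mul_le _ _)
      by_contra hne
      have : 0 < ‖z * Q‖ := norm_pos_iff.2 hne
      nlinarith
    have hQz : Q * z = 0 := by
      simpa [hzsa, hQ.isSelfAdjoint.star_eq] using congrArg star hzQ
    set X := 1 + s * z with hXdef
    have hQX : Q * X = Q := by
      rw [hXdef]
      linear_combination (norm := noncomm_ring) hQs * z + hQz
    have hsX : star X = 1 + z * s := by simp [hXdef, hssa, hzsa]
    have hXSX : star X * (T₀ + Q) * X = complCompression Q T := by
      have h3 : complCompression Q T = D + (T₀ + Q) := by rw [hD]; abel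
      rw [h3, ← hyeq, hsX, hXdef, two_smul]
      linear_combination (norm := noncomm_ring) z * hsv + hvs * z + z * hsv * (s * z)
    set W := Ring.inverse X with hW
    have hXW : X * W = 1 := Ring.mul_inverse_cancel _ hXu
    have hWX : star W * star X = 1 := by rw [← star_mul, hXW, star_one]
    have hQW : Q * W = Q := by
      calc Q * W = Q * X * W := by rw [hQX]
        _ = Q := by rw [mul_assoc, hXW, mul_one]
    have hWQ : star W * Q = Q := by
      simpa [hQ.isSelfAdjoint.star_eq] using congrArg star hQW
    have hzXQ : X * Q = Q := by
      rw [hXdef]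
      linear_combination (norm := noncomm_ring) s * hzQ
    have hWXQ : W * Q = Q := by
      have hWX' : W * X = 1 := Ring.inverse_mul_cancel _ hXu
      calc W * Q = W * (X * Q) := by rw [hzXQ]
        _ = Q := by rw [← mul_assoc, hWX', one_mul]
    have hQsW : Q * star W = Q := by
      simpa [hQ.isSelfAdjoint.star_eq] using congrArg star hWXQ
    have hel := compl_mul_eliminate hQ hu
    have key : (1 - Q) * (star W * eliminate Q T * W) = T₀ := by
      have h4 : (1 - Q) * star W = star W * (1 - Q) := by
        rw [sub_mul, mul_sub, hWQ, hQsW]; simp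
      calc (1 - Q) * (star W * eliminate Q T * W)
          = (1 - Q) * star W * eliminate Q T * W := by noncomm_ring
        _ = star W * ((1 - Q) * eliminate Q T) * W := by rw [h4]; noncomm_ring
        _ = star W * (star X * (T₀ + Q) * X - Q) * W := by rw [hel, hXSX]
        _ = T₀ := by
          linear_combination (norm := noncomm_ring)
            hWX * (T₀ + Q) * X * W + (T₀ + Q) * hXW - hWQ * W - hQW
    have key2 : (1 - Q) * (star ((1 - eliminator Q T) * W) * T * ((1 - eliminator Q T) * W)
        - T₀) = 0 := by
      have h5 : star ((1 - eliminator Q T) * W) * T * ((1 - eliminator Q T) * W)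
          = star W * eliminate Q T * W := by
        rw [star_mul, eliminate]; noncomm_ring
      rw [h5, mul_sub, key, sub_mul, hQT₀]; simp
    intro x
    have h6 := congrArg (fun A : H →L[ℝ] H => A x) key2
    simp only [mul_apply_eq_comp] at h6
    rw [← Submodule.starProjection_eq_self_iff, ← hQdef]
    generalize (star ((1 - eliminator Q T) * W) * T * ((1 - eliminator Q T) * W) - T₀) x = w at h6 ⊢
    have h7 : w - Q w = 0 := h6
    exact (sub_eq_zero.1 h7).symm

end LocalCongruence

/-! ### Compactness arguments on intervals -/

section Interval

/-- The retraction of the unit interval onto `[c, d]`. -/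
def clamp (c d x : unitInterval) : unitInterval := max c (min d x)

theorem continuous_clamp (c d : unitInterval) : Continuous (clamp c d) := by
  unfold clamp; fun_prop

theorem clamp_mem {c d : unitInterval} (h : c ≤ d) (x : unitInterval) :
    clamp c d x ∈ Set.Icc c d :=
  ⟨le_max_left _ _, max_le h (min_le_left _ _)⟩

theorem clamp_of_mem {c d x : unitInterval} (h : x ∈ Set.Icc c d) : clamp c d x = x := by
  simp [clamp, h.1, h.2]

theorem monotone_clamp (c d : unitInterval) : Monotone (clamp c d) :=
  fun _ _ h => max_le_max le_rfl (min_le_min le_rfl h)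

/-- A transitive relation that holds on all small subintervals holds on the whole interval: chain it
along a fine partition. Retracting by `clamp` turns a cover of `[c, d]` into one of the unit
interval. -/
theorem interval_induction {c d : unitInterval} (hcd : c ≤ d)
    (R : unitInterval → unitInterval → Prop)
    (htrans : ∀ x y z, c ≤ x → x ≤ y → y ≤ z → z ≤ d → R x y → R y z → R x z)
    (hloc : ∀ x ∈ Set.Icc c d, ∃ U : Set unitInterval, IsOpen U ∧ x ∈ U ∧
      ∀ y z, c ≤ y → y ≤ z → z ≤ d → Set.Icc y z ⊆ U → R y z) : R c d := by
  have hloc' : ∀ x, ∃ U : Set unitInterval, IsOpen U ∧ clamp c d x ∈ U ∧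
      ∀ y z, c ≤ y → y ≤ z → z ≤ d → Set.Icc y z ⊆ U → R y z :=
    fun x => hloc _ (clamp_mem hcd x)
  choose U hUo hxU hU using hloc'
  obtain ⟨t, ht0, htm, ⟨n, hn⟩, ht⟩ := exists_monotone_Icc_subset_open_cover_unitInterval
    (c := fun x => clamp c d ⁻¹' U x) (fun x => (hUo x).preimage (continuous_clamp c d))
    (fun x _ => Set.mem_iUnion.2 ⟨x, hxU x⟩)
  have hstep : ∀ k, R (clamp c d (t k)) (clamp c d (t (k + 1))) := by
    intro k
    obtain ⟨i, hi⟩ := ht k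
    have hk := htm (Nat.le_succ k)
    refine hU i _ _ (clamp_mem hcd _).1 (monotone_clamp c d hk) (clamp_mem hcd _).2 ?_
    intro w hw
    have hwm : w ∈ Set.Icc c d :=
      ⟨(clamp_mem hcd _).1.trans hw.1, hw.2.trans (clamp_mem hcd _).2⟩
    rcases le_total (t k) w with h1 | h1
    · rcases le_total w (t (k + 1)) with h2 | h2
      · have := hi ⟨h1, h2⟩
        rwa [Set.mem_preimage, clamp_of_mem hwm] at this
      · have h3 := monotone_clamp c d h2
        rw [clamp_of_mem hwm] at h3
        rw [← le_antisymm h3 hw.2]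
        exact hi ⟨hk, le_rfl⟩
    · have h3 := monotone_clamp c d h1
      rw [clamp_of_mem hwm] at h3
      rw [← le_antisymm hw.1 h3]
      exact hi ⟨le_rfl, hk⟩
  have hall : ∀ k, R c (clamp c d (t (k + 1))) := by
    intro k
    induction k with
    | zero =>
      have := hstep 0
      rwa [ht0, show clamp c d 0 = c by simp [clamp]] at this
    | succ k ih =>
      exact htrans _ _ _ le_rfl (clamp_mem hcd _).1 (monotone_clamp c d (htm (Nat.le_succ _)))
        (clamp_mem hcd _).2 ih (hstep (k + 1))
  have := hall n
  rwa [hn (n + 1) (Nat.le_succ n), show clamp c d 1 = d by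
    simp [clamp, hcd, unitInterval.le_one']] at this

end Interval

/-! ### Gluing congruences and transporting projections -/

section Gluing

variable {H : Type u} [NormedAddCommGroup H] [InnerProductSpace ℝ H] [CompleteSpace H]

theorem continuous_star_operator : Continuous (star : (H →L[ℝ] H) → (H →L[ℝ] H)) :=
  (ContinuousLinearMap.adjoint (𝕜 := ℝ) (E := H) (F := H)).continuous

/-- A path of selfadjoint Fredholm operators is congruent to a path of perturbations of its
initial operator with values in a fixed finite-dimensional subspace. -/
theorem exists_congruence_finite_rank {L : unitInterval → H →L[ℝ] H} (hL : Continuous L)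
    (hF : ∀ t, L t ∈ fredholmSelfAdjoint H) :
    ∃ M : unitInterval → H →L[ℝ] H, Continuous M ∧ (∀ t, IsUnit (M t)) ∧ M 0 = 1 ∧
      ∃ E : Submodule ℝ H, FiniteDimensional ℝ E ∧
        ∀ t x, (star (M t) * L t * M t - L 0) x ∈ E := by
  have key := interval_induction (zero_le_one : (0 : unitInterval) ≤ 1)
    (fun s s' => ∃ M : unitInterval → H →L[ℝ] H, Continuous M ∧ (∀ t, IsUnit (M t)) ∧ M s = 1 ∧
      ∃ E : Submodule ℝ H, FiniteDimensional ℝ E ∧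
        ∀ t ∈ Set.Icc s s', ∀ x, (star (M t) * L t * M t - L s) x ∈ E) ?_ ?_
  · obtain ⟨M, h1, h2, h3, E, h4, h5⟩ := key
    exact ⟨M, h1, h2, h3, E, h4, fun t => h5 t ⟨t.2.1, t.2.2⟩⟩
  · rintro x y z - hxy hyz - ⟨M, hMc, hMu, hM1, E, hE, hEM⟩ ⟨M', hMc', hMu', hM1', E', hE', hEM'⟩
    -- Because `M' y = 1`, this is `M t` before `y` and `M' t * M y` after it; the new perturbation
    -- is then conjugated by `M y`, which accounts for the second summand of the subspace.
    refine ⟨fun t => M' (max t y) * M (min t y), by fun_prop, fun t => (hMu' _).mul (hMu _),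
      by simp [hxy, hM1, hM1'], E ⊔ E'.map (star (M y) : H →L[ℝ] H).toLinearMap, inferInstance,
      fun t ht v => ?_⟩
    rcases le_total t y with h | h
    · simp only [max_eq_right h, min_eq_left h, hM1', one_mul]
      exact Submodule.mem_sup_left (hEM t ⟨ht.1, h⟩ v)
    · simp only [max_eq_left h, min_eq_right h]
      have h1 : star (M' t * M y) * L t * (M' t * M y) - L x
          = (star (M y) * L y * M y - L x)
            + star (M y) * (star (M' t) * L t * M' t - L y) * M y := by
        rw [star_mul]; noncomm_ring
      rw [h1, add_apply]
      refine Submodule.add_mem_sup (hEM y ⟨hxy, le_rfl⟩ v) ?_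
      exact ⟨_, hEM' t ⟨h, ht.2⟩ (M y v), rfl⟩
  · intro x _
    obtain ⟨E, hE, U, hUo, hxU, Γ, hΓc, hΓ⟩ := exists_local_congruence (hF x)
    refine ⟨L ⁻¹' U, hUo.preimage hL, hxU, fun y z _ hyz _ hsub => ?_⟩
    have hy : L y ∈ U := hsub ⟨le_rfl, hyz⟩
    obtain ⟨w, hw⟩ := (hΓ _ hy).1
    -- Dividing by the value at `y` normalises the family there. The difference of two perturbations
    -- of `L x` with values in `E` again has values in `E`, so the base point `x` disappears.
    refine ⟨fun t => Γ (L (clamp y z t)) * (↑w⁻¹ : H →L[ℝ] H), ?_, fun t => ?_, ?_,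
      E.map (star (↑w⁻¹ : H →L[ℝ] H) : H →L[ℝ] H).toLinearMap, inferInstance, fun t ht v => ?_⟩
    · refine Continuous.mul ?_ continuous_const
      exact hΓc.comp_continuous (hL.comp (continuous_clamp y z)) fun t => hsub (clamp_mem hyz t)
    · exact ((hΓ _ (hsub (clamp_mem hyz t))).1).mul (Units.isUnit _)
    · simp only [clamp_of_mem (⟨le_rfl, hyz⟩ : y ∈ Set.Icc y z), ← hw, Units.mul_inv]
    · simp only [clamp_of_mem ht]
      have h1 : star (↑w⁻¹ : H →L[ℝ] H) * (star (Γ (L y)) * L y * Γ (L y)) * (↑w⁻¹ : H →L[ℝ] H)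
          = L y := by
        have e1 : Γ (L y) * (↑w⁻¹ : H →L[ℝ] H) = 1 := by rw [← hw, Units.mul_inv]
        have e2 : star (↑w⁻¹ : H →L[ℝ] H) * star (Γ (L y)) = 1 := by
          rw [← star_mul, e1, star_one]
        linear_combination (norm := noncomm_ring)
          e2 * L y * Γ (L y) * (↑w⁻¹ : H →L[ℝ] H) + L y * e1
      have h2 : star (Γ (L t) * (↑w⁻¹ : H →L[ℝ] H)) * L t * (Γ (L t) * (↑w⁻¹ : H →L[ℝ] H)) - L y
          = star (↑w⁻¹ : H →L[ℝ] H) * ((star (Γ (L t)) * L t * Γ (L t) - L x)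
            - (star (Γ (L y)) * L y * Γ (L y) - L x)) * (↑w⁻¹ : H →L[ℝ] H) := by
        conv_lhs => rw [← h1]
        rw [star_mul]; noncomm_ring
      rw [h2]
      exact ⟨_, E.sub_mem ((hΓ _ (hsub ht)).2 (hF t).1 _) ((hΓ _ hy).2 (hF y).1 _), rfl⟩

/-- The operator differs from `1` by at most `2 * ‖P' - P‖`. When `P'` is idempotent too, it
intertwines `P` with `P'`. -/
theorem isUnit_intertwiner {P P' : H →L[ℝ] H} (hP : IsStarProjection P) (h1 : ‖P‖ ≤ 1)
    (h2 : ‖1 - P‖ ≤ 1) (h : ‖P' - P‖ < 1 / 2) : IsUnit (P' * P + (1 - P') * (1 - P)) := by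
  have e : P' * P + (1 - P') * (1 - P) = 1 + ((P' - P) * P - (P' - P) * (1 - P)) := by
    linear_combination (norm := noncomm_ring) (2 : H →L[ℝ] H) * hP.isIdempotentElem.eq
  rw [e]
  refine isUnit_one_add_of_norm_lt_one ?_
  calc ‖(P' - P) * P - (P' - P) * (1 - P)‖
      ≤ ‖P' - P‖ * ‖P‖ + ‖P' - P‖ * ‖1 - P‖ :=
        (norm_sub_le _ _).trans (add_le_add (norm_mul_le _ _) (norm_mul_le _ _))
    _ ≤ ‖P' - P‖ * 1 + ‖P' - P‖ * 1 := by gcongr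
    _ < 1 := by linarith

/-- Parallel transport along a continuous family of orthogonal projections. -/
theorem exists_transport {c d : unitInterval} (hcd : c ≤ d) {P : unitInterval → H →L[ℝ] H}
    (hP : ∀ t, ∃ E : Submodule ℝ H, ∃ _ : E.HasOrthogonalProjection, P t = E.starProjection)
    (hc : ContinuousOn P (Set.Icc c d)) :
    ∃ U : unitInterval → H →L[ℝ] H, Continuous U ∧ (∀ t, IsUnit (U t)) ∧ U c = 1 ∧
      ∀ t ∈ Set.Icc c d, U t * P c = P t * U t := by
  have hPs : ∀ t, IsStarProjection (P t) := by
    intro t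
    obtain ⟨E, _, hE⟩ := hP t
    rw [hE]; exact isStarProjection_starProjection
  have hPn : ∀ t, ‖P t‖ ≤ 1 ∧ ‖1 - P t‖ ≤ 1 := by
    intro t
    obtain ⟨E, _, hE⟩ := hP t
    rw [hE]
    refine ⟨E.starProjection_norm_le, ?_⟩
    rw [← Submodule.starProjection_orthogonal']
    exact Eᗮ.starProjection_norm_le
  refine interval_induction hcd (fun s s' => ∃ U : unitInterval → H →L[ℝ] H, Continuous U ∧
    (∀ t, IsUnit (U t)) ∧ U s = 1 ∧ ∀ t ∈ Set.Icc s s', U t * P s = P t * U t) ?_ ?_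
  · rintro x y z - hxy hyz - ⟨M, hMc, hMu, hM1, hE⟩ ⟨M', hMc', hMu', hM1', hE'⟩
    refine ⟨fun t => M' (max t y) * M (min t y), by fun_prop, fun t => (hMu' _).mul (hMu _),
      by simp [hxy, hM1, hM1'], fun t ht => ?_⟩
    rcases le_total t y with h | h
    · simp only [max_eq_right h, min_eq_left h, hM1', one_mul]
      exact hE t ⟨ht.1, h⟩
    · simp only [max_eq_left h, min_eq_right h]
      rw [mul_assoc, hE y ⟨hxy, le_rfl⟩, ← mul_assoc, hE' t ⟨h, ht.2⟩, mul_assoc]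
  · intro x hx
    have hcl : Continuous fun t => P (clamp c d t) :=
      hc.comp_continuous (continuous_clamp c d) (clamp_mem hcd)
    -- Within `1/4` of `P x`, any two projections are within `1/2` of each other.
    refine ⟨{t | ‖P (clamp c d t) - P x‖ < 1 / 4}, isOpen_lt (hcl.sub continuous_const).norm continuous_const,
      by simp [clamp_of_mem hx], fun y z hcy hyz hzd hsub => ?_⟩
    have hn : ∀ t ∈ Set.Icc y z, ‖P t - P y‖ < 1 / 2 := by
      intro t ht
      have e1 := hsub ht
      have e2 := hsub (⟨le_rfl, hyz⟩ : y ∈ Set.Icc y z)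
      simp only [Set.mem_ofPred_eq] at e1 e2
      rw [clamp_of_mem ⟨hcy.trans ht.1, ht.2.trans hzd⟩] at e1
      rw [clamp_of_mem ⟨hcy, hyz.trans hzd⟩] at e2
      calc ‖P t - P y‖ ≤ ‖P t - P x‖ + ‖P x - P y‖ := norm_sub_le_norm_sub_add_norm_sub _ _ _
        _ < 1 / 2 := by rw [norm_sub_rev (P x)]; linarith
    have hPc : Continuous fun t => P (clamp y z t) :=
      hc.comp_continuous (continuous_clamp y z) fun t =>
        ⟨hcy.trans (clamp_mem hyz t).1, (clamp_mem hyz t).2.trans hzd⟩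
    have hi := fun t => (hPs t).isIdempotentElem.eq
    refine ⟨fun t => P (clamp y z t) * P y + (1 - P (clamp y z t)) * (1 - P y),
      (hPc.mul continuous_const).add ((continuous_const.sub hPc).mul continuous_const),
      fun t => isUnit_intertwiner (hPs y) (hPn y).1 (hPn y).2 (hn _ (clamp_mem hyz t)), ?_, ?_⟩
    · simp only [clamp_of_mem (⟨le_rfl, hyz⟩ : y ∈ Set.Icc y z)]
      linear_combination (norm := noncomm_ring) (2 : H →L[ℝ] H) * hi y
    · intro t ht
      simp only [clamp_of_mem ht]
      linear_combination (norm := noncomm_ring)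
        (P t) * hi y - (1 - P t) * hi y - hi t * P y + hi t * (1 - P y)

end Gluing

/-! ### Compressions to subspaces and their complements -/

section Compression

variable {H : Type u} [NormedAddCommGroup H] [InnerProductSpace ℝ H] [CompleteSpace H]

theorem commute_of_compl_mul_mul_eq_zero {P T : H →L[ℝ] H} (hP : IsStarProjection P)
    (hT : IsSelfAdjoint T) (h : (1 - P) * T * P = 0) : Commute P T := by
  have h' : P * T * (1 - P) = 0 := by
    simpa [hP.isSelfAdjoint.star_eq, hT.star_eq, mul_assoc] using congrArg star h
  change P * T = T * P
  linear_combination (norm := noncomm_ring) h' - h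

/-- The compression of an operator to a subspace. -/
noncomputable def compress (E : Submodule ℝ H) [E.HasOrthogonalProjection] (T : H →L[ℝ] H) :
    E →L[ℝ] E :=
  E.orthogonalProjectionOnto ∘L T ∘L E.subtypeL

section

variable (E : Submodule ℝ H) [E.HasOrthogonalProjection]

theorem coe_compress (T : H →L[ℝ] H) (x : E) :
    (compress E T x : H) = E.starProjection (T x) := rfl

theorem inner_compress (T : H →L[ℝ] H) (x y : E) :
    inner ℝ (compress E T x) y = inner ℝ (T x) (y : H) := by
  rw [Submodule.coe_inner, coe_compress, Submodule.inner_starProjection_left_eq_right,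
    Submodule.starProjection_eq_self_iff.2 y.2]

theorem continuous_compress : Continuous (compress E) := by
  unfold compress; fun_prop

theorem isSelfAdjoint_compress [CompleteSpace E] {T : H →L[ℝ] H} (hT : IsSelfAdjoint T) :
    IsSelfAdjoint (compress E T) := by
  rw [ContinuousLinearMap.isSelfAdjoint_iff_isSymmetric]
  intro x y
  change inner ℝ (compress E T x) y = inner ℝ x (compress E T y)
  rw [inner_compress, ← real_inner_comm x, inner_compress, inner_selfAdjoint hT, real_inner_comm]

theorem coe_compress_of_commute {T : H →L[ℝ] H} (h : Commute E.starProjection T) (x : E) :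
    (compress E T x : H) = T x := by
  rw [coe_compress, ← mul_apply_eq_comp, h.eq, mul_apply_eq_comp,
    Submodule.starProjection_eq_self_iff.2 x.2]

theorem isUnit_compress_orthogonal {T : H →L[ℝ] H} (h : Commute E.starProjection T)
    (hu : IsUnit (complCompression E.starProjection T)) : IsUnit (compress Eᗮ T) := by
  have h' : Commute Eᗮ.starProjection T := by
    rw [Submodule.starProjection_orthogonal']
    exact (Commute.one_left T).sub_left h
  have hP : ∀ x : H, x ∈ Eᗮ → E.starProjection x = 0 := fun x hx =>
    (Submodule.starProjection_apply_eq_zero_iff _).2 hx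
  have hval : ∀ x : Eᗮ, complCompression E.starProjection T x = T x := by
    intro x
    have h1 : T x ∈ Eᗮ := by rw [← coe_compress_of_commute Eᗮ h' x]; exact Subtype.mem _
    simp [complCompression, hP _ x.2, hP _ h1]
  have hbij := ContinuousLinearMap.isUnit_iff_bijective.1 hu
  rw [ContinuousLinearMap.isUnit_iff_bijective]
  constructor
  · refine (injective_iff_map_eq_zero _).2 fun x hx => ?_
    have h1 : T x = 0 := by rw [← coe_compress_of_commute Eᗮ h' x, hx]; rfl
    exact Subtype.ext (injective_of_isUnit hu (by rw [hval, h1]))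
  · intro y
    obtain ⟨z, hz⟩ := hbij.2 (y : H)
    have hPz : E.starProjection z = 0 := by
      have h2 : E.starProjection * complCompression E.starProjection T = E.starProjection := by
        have := (isStarProjection_starProjection (U := E)).isIdempotentElem.eq
        unfold complCompression
        linear_combination (norm := noncomm_ring) this - this * T * (1 - E.starProjection)
      rw [← hP y y.2, ← hz, ← mul_apply_eq_comp, h2]
    have hz' : z ∈ Eᗮ := (Submodule.starProjection_apply_eq_zero_iff _).1 hPz
    refine ⟨⟨z, hz'⟩, Subtype.ext ?_⟩
    rw [coe_compress_of_commute Eᗮ h', ← hval ⟨z, hz'⟩, hz]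

end

variable (E : Submodule ℝ H) [FiniteDimensional ℝ E]

/-- The completed block is a selfadjoint finite-rank perturbation of `T`, so injectivity suffices;
the hypothesis is exactly triviality of its kernel. -/
theorem isUnit_complCompression {T : H →L[ℝ] H} (hT : T ∈ fredholmSelfAdjoint H)
    (h : ∀ v, E.starProjection v = 0 → T v ∈ E → v = 0) :
    IsUnit (complCompression E.starProjection T) := by
  set P := E.starProjection with hPdef
  have hP : IsStarProjection P := isStarProjection_starProjection
  have hPf : (P : H →ₗ[ℝ] H).HasFiniteRange := starProjection_hasFiniteRange E
  have e : complCompression P T = T + (P - P * T - (1 - P) * (T * P)) := by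
    unfold complCompression; noncomm_ring
  have hsa : IsSelfAdjoint (P - P * T - (1 - P) * (T * P)) := by
    have : P - P * T - (1 - P) * (T * P) = complCompression P T - T := by rw [e]; abel
    rw [this]
    simp [IsSelfAdjoint, complCompression, hP.isSelfAdjoint.star_eq, hT.1.star_eq, mul_assoc]
  have hf : ((P - P * T - (1 - P) * (T * P) : H →L[ℝ] H) : H →ₗ[ℝ] H).HasFiniteRange :=
    (hPf.sub (hPf.comp_right T.toLinearMap)).sub
      ((hPf.comp_left T.toLinearMap).comp_left (1 - P : H →L[ℝ] H).toLinearMap)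
  have hF : complCompression P T ∈ fredholmSelfAdjoint H := by
    rw [e]; exact add_mem_fredholmSelfAdjoint hT hsa hf
  refine isUnit_of_injective hF fun v hv => ?_
  have hv1 : P v = 0 := by
    have h2 : P * complCompression P T = P := by
      unfold complCompression
      linear_combination (norm := noncomm_ring)
        hP.isIdempotentElem.eq - hP.isIdempotentElem.eq * T * (1 - P)
    rw [← h2, mul_apply_eq_comp, hv, map_zero]
  refine h v hv1 ?_
  rw [← Submodule.starProjection_eq_self_iff, ← hPdef]
  have : T v - P (T v) = 0 := by simpa [complCompression, hv1] using hv
  exact (sub_eq_zero.1 this).symm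

/-- The obstruction for `E` is `R = Eᗮ ⊓ T⁻¹ E`, finite-dimensional because `T` is injective. Adding
`R` creates no new obstruction: if `v` is orthogonal to `E ⊔ R` and `T v = e + r`, then `r` is
orthogonal to `e`, and to `T v` because `T r ∈ E`. Hence `r = 0` and `v ∈ R`, so `v = 0`. -/
theorem exists_finiteDimensional_isUnit_complCompression {T : H →L[ℝ] H} (hT : IsSelfAdjoint T)
    (hu : IsUnit T) : ∃ (F : Submodule ℝ H) (_ : FiniteDimensional ℝ F), E ≤ F ∧
      IsUnit (complCompression F.starProjection T) := by
  set R : Submodule ℝ H := Eᗮ ⊓ E.comap T.toLinearMap with hR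
  have hRf : FiniteDimensional ℝ R := by
    let f : R →ₗ[ℝ] E := (T.toLinearMap.domRestrict R).codRestrict E fun x => x.2.2
    refine FiniteDimensional.of_injective f fun x y hxy => Subtype.ext ?_
    have : T x = T y := congrArg Subtype.val hxy
    exact (ContinuousLinearMap.isUnit_iff_bijective.1 hu).1 this
  refine ⟨E ⊔ R, inferInstance, le_sup_left, ?_⟩
  refine isUnit_complCompression _ (mem_fredholmSelfAdjoint_of_isUnit hT hu) fun v hv hTv => ?_
  rw [Submodule.starProjection_apply_eq_zero_iff, ← Submodule.inf_orthogonal] at hv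
  obtain ⟨e, he, r, hr, her⟩ := Submodule.mem_sup.1 hTv
  have hr0 : r = 0 := by
    have h1 : inner ℝ r (T v) = 0 := by
      rw [← inner_selfAdjoint hT]
      exact Submodule.inner_right_of_mem_orthogonal hr.2 hv.1
    have h2 : inner ℝ r e = 0 := Submodule.inner_left_of_mem_orthogonal he hr.1
    rw [← her, inner_add_right, h2, zero_add] at h1
    exact inner_self_eq_zero.1 h1
  have hvR : v ∈ R := ⟨hv.1, by
    change T v ∈ E
    rw [← her, hr0, add_zero]; exact he⟩
  exact inner_self_eq_zero.1 (Submodule.inner_right_of_mem_orthogonal hvR hv.2 : inner ℝ v v = 0)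

end Compression

/-! ### Consequences of the axioms for the invariant -/

section Invariant

variable {μ : PathInvariant.{u}}
variable {H : Type u} [NormedAddCommGroup H] [InnerProductSpace ℝ H] [CompleteSpace H]
  [SeparableSpace H]

theorem invariant_eq_of_congruence (hH : HomotopyProperty μ) {L L' : FredholmPath H}
    {G : unitInterval × unitInterval → H →L[ℝ] H} (hG : Continuous G) (hu : ∀ p, IsUnit (G p))
    (h0 : ∀ s, G (0, s) = 1) (hL' : ∀ s, L' s = star (G (1, s)) * L s * G (1, s)) :
    μ H L = μ H L' := by
  refine hH H (fun p => star (G p) * L p.2 * G p) ?_ ?_ ?_ L L' ?_ hL'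
  · exact ((continuous_star_operator.comp hG).mul (L.continuous_toFun.comp continuous_snd)).mul hG
  · exact fun p => congruence_mem_fredholmSelfAdjoint (L.mem_fredholmSelfAdjoint _) (hu p)
  · exact fun s => ⟨((hu _).star.mul L.isUnit_zero).mul (hu _),
      ((hu _).star.mul L.isUnit_one).mul (hu _)⟩
  · intro t; simp [h0]

/-- The path splits over `E` and `Eᗮ`. The part on `Eᗮ` is invertible and contributes `0`; the part
on `E` is evaluated by the Morse property. -/
theorem invariant_eq_of_commute (hZ : ZeroProperty μ) (hA : AdditivityProperty μ)
    (hM : MorseProperty μ) (N : FredholmPath H) (E : Submodule ℝ H) [FiniteDimensional ℝ E]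
    (hc : ∀ s, Commute E.starProjection (N s))
    (hu : ∀ s, IsUnit (complCompression E.starProjection (N s))) :
    μ H N = (morseIndex (compress E (N 0)) : ℤ) - morseIndex (compress E (N 1)) := by
  have hunit : ∀ s, IsUnit (N s) → IsUnit (compress E (N s)) := fun s hs =>
    isUnit_of_injective (mem_fredholmSelfAdjoint_of_finiteDimensional
      (isSelfAdjoint_compress E (N.mem_fredholmSelfAdjoint s).1)) fun x hx => by
        have : N s x = 0 := by rw [← coe_compress_of_commute E (hc s) x, hx]; rfl
        exact Subtype.ext (injective_of_isUnit hs this)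
  let L₁ : FredholmPath E :=
    { toFun := fun s => compress E (N s)
      continuous_toFun := (continuous_compress E).comp N.continuous_toFun
      mem_fredholmSelfAdjoint := fun s => mem_fredholmSelfAdjoint_of_finiteDimensional
        (isSelfAdjoint_compress E (N.mem_fredholmSelfAdjoint s).1)
      isUnit_zero := hunit _ N.isUnit_zero
      isUnit_one := hunit _ N.isUnit_one }
  have hunit' : ∀ s, IsUnit (compress Eᗮ (N s)) := fun s =>
    isUnit_compress_orthogonal E (hc s) (hu s)
  let L₂ : FredholmPath Eᗮ :=
    { toFun := fun s => compress Eᗮ (N s)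
      continuous_toFun := (continuous_compress Eᗮ).comp N.continuous_toFun
      mem_fredholmSelfAdjoint := fun s => mem_fredholmSelfAdjoint_of_isUnit
        (isSelfAdjoint_compress Eᗮ (N.mem_fredholmSelfAdjoint s).1) (hunit' s)
      isUnit_zero := hunit' 0
      isUnit_one := hunit' 1 }
  rw [hA H E Eᗮ (Submodule.isCompl_orthogonal E)
    (Submodule.isOrtho_orthogonal_right E) N L₁ L₂
    (fun t x => coe_compress_of_commute E (hc t) x)
    (fun t x => coe_compress_of_commute Eᗮ (by
      rw [Submodule.starProjection_orthogonal']
      exact (Commute.one_left _).sub_left (hc t)) x), hZ _ L₂ hunit', add_zero, hM]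

theorem invariant_eq_eliminate (hZ : ZeroProperty μ) (hA : AdditivityProperty μ)
    (hH : HomotopyProperty μ) (hM : MorseProperty μ) (N : FredholmPath H) (E : Submodule ℝ H)
    [FiniteDimensional ℝ E] (hu : ∀ s, IsUnit (complCompression E.starProjection (N s))) :
    μ H N = (morseIndex (compress E (eliminate E.starProjection (N 0))) : ℤ)
      - morseIndex (compress E (eliminate E.starProjection (N 1))) := by
  set P := E.starProjection with hPdef
  have hP : IsStarProjection P := isStarProjection_starProjection
  have hPi := hP.isIdempotentElem.eq
  have hcont : Continuous fun s => eliminator P (N s) := continuous_iff_continuousAt.2 fun s =>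
    ContinuousAt.comp (g := eliminator P) (continuousAt_eliminator (hu s))
      N.continuous_toFun.continuousAt
  have hY : ∀ s, IsUnit (1 - eliminator P (N s)) := fun s => by
    simpa using isUnit_one_sub_smul_eliminator (T := N s) hPi 1
  let N' : FredholmPath H :=
    { toFun := fun s => eliminate P (N s)
      continuous_toFun :=
        ((continuous_star_operator.comp (continuous_const.sub hcont)).mul
          N.continuous_toFun).mul (continuous_const.sub hcont)
      mem_fredholmSelfAdjoint := fun s =>
        congruence_mem_fredholmSelfAdjoint (N.mem_fredholmSelfAdjoint s) (hY s)
      isUnit_zero := ((hY _).star.mul N.isUnit_zero).mul (hY _)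
      isUnit_one := ((hY _).star.mul N.isUnit_one).mul (hY _) }
  have h1 : μ H N = μ H N' := by
    refine invariant_eq_of_congruence hH
      (G := fun p => 1 - (p.1 : ℝ) • eliminator P (N p.2)) ?_ ?_ ?_ ?_
    · exact continuous_const.sub
        ((continuous_subtype_val.comp continuous_fst).smul (hcont.comp continuous_snd))
    · exact fun p => isUnit_one_sub_smul_eliminator hPi _
    · intro s; simp
    · intro s; simp [N', eliminate]
  rw [h1]
  refine invariant_eq_of_commute hZ hA hM N' E (fun s => ?_) (fun s => ?_)
  · exact commute_of_compl_mul_mul_eq_zero hP (N'.mem_fredholmSelfAdjoint s).1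
      (compl_mul_eliminate_mul hP (hu s))
  · change IsUnit (complCompression P (eliminate P (N s)))
    rw [complCompression_eliminate hP (hu s)]
    exact hu s

/-- On all subintervals with invertible end operators, the invariant of a path is the difference
of the values of one function at the ends. -/
theorem exists_relative_index (hZ : ZeroProperty μ) (hA : AdditivityProperty μ)
    (hH : HomotopyProperty μ) (hM : MorseProperty μ) (L : FredholmPath H) :
    ∃ m : unitInterval → ℤ, ∀ c d : unitInterval, c ≤ d → ∀ Λ : FredholmPath H,
      (∀ s, Λ s = L (clamp c d s)) → μ H Λ = m c - m d := by
  -- The congruence and the subspace are chosen for the whole path, before `c` and `d`. Hence the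
  -- index assigned to a point does not depend on the subinterval.
  obtain ⟨M, hMc, hMu, hM0, E₀, hE₀, hE⟩ :=
    exists_congruence_finite_rank L.continuous_toFun L.mem_fredholmSelfAdjoint
  obtain ⟨E, hEf, hle, hEu⟩ := exists_finiteDimensional_isUnit_complCompression E₀
    (L.mem_fredholmSelfAdjoint 0).1 L.isUnit_zero
  set P := E.starProjection with hPdef
  refine ⟨fun t => morseIndex (compress E (eliminate P (star (M t) * L t * M t))),
    fun c d hcd Λ hΛ => ?_⟩
  have hcl := continuous_clamp c d
  let N : FredholmPath H :=
    { toFun := fun s => star (M (clamp c d s)) * Λ s * M (clamp c d s)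
      continuous_toFun := ((continuous_star_operator.comp (hMc.comp hcl)).mul
        Λ.continuous_toFun).mul (hMc.comp hcl)
      mem_fredholmSelfAdjoint := fun s =>
        congruence_mem_fredholmSelfAdjoint (Λ.mem_fredholmSelfAdjoint s) (hMu _)
      isUnit_zero := ((hMu _).star.mul Λ.isUnit_zero).mul (hMu _)
      isUnit_one := ((hMu _).star.mul Λ.isUnit_one).mul (hMu _) }
  have h1 : μ H Λ = μ H N := by
    -- Scaling the argument contracts the congruence to `M 0 = 1`.
    refine invariant_eq_of_congruence hH (G := fun p => M (p.1 * clamp c d p.2)) ?_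
      (fun p => hMu _) ?_ ?_
    · exact hMc.comp (continuous_fst.mul (hcl.comp continuous_snd))
    · intro s; simp [hM0]
    · intro s; simp [N]
  rw [h1, invariant_eq_eliminate hZ hA hH hM N E]
  · simp only [N, hΛ]
    rw [show clamp c d 0 = c by simp [clamp], show clamp c d 1 = d by
      simp [clamp, hcd, unitInterval.le_one']]
  · intro s
    -- The perturbation takes values in `E`, so `1 - P` kills it: the complementary block is that of
    -- `L 0` for every `s`.
    have h2 : complCompression P (N s) = complCompression P (L 0) := by
      have h3 : (1 - P) * (N s - L 0) = 0 := by
        ext x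
        have h4 : (N s - L 0) x ∈ E := hle (by
          have := hE (clamp c d s) x
          rw [← hΛ] at this
          exact this)
        rw [mul_apply_eq_comp]
        generalize (N s - L 0) x = w at h4
        change w - P w = 0
        rw [hPdef, Submodule.starProjection_eq_self_iff.2 h4, sub_self]
      unfold complCompression
      linear_combination (norm := noncomm_ring) h3 * (1 - P)
    rw [h2]; exact hEu

/-- Transport replaces the moving subspaces by the fixed one `S c`, at the price of a congruence by
`U`, so that the decoupled case applies. -/
theorem invariant_eq_of_projections (hZ : ZeroProperty μ) (hA : AdditivityProperty μ)
    (hH : HomotopyProperty μ) (hM : MorseProperty μ) {L : unitInterval → H →L[ℝ] H}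
    {c d : unitInterval} (hcd : c ≤ d) (Λ : FredholmPath H) (hΛ : ∀ s, Λ s = L (clamp c d s))
    (S : unitInterval → Submodule ℝ H) [∀ t, (S t).HasOrthogonalProjection]
    [FiniteDimensional ℝ (S c)]
    (hSc : ContinuousOn (fun t => (S t).starProjection) (Set.Icc c d))
    (hcomm : ∀ t ∈ Set.Icc c d, Commute (S t).starProjection (L t))
    (hu : ∀ t ∈ Set.Icc c d, IsUnit (complCompression (S t).starProjection (L t))) :
    ∃ U : H →L[ℝ] H, IsUnit U ∧ U * (S c).starProjection = (S d).starProjection * U ∧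
      μ H Λ = (morseIndex (compress (S c) (L c)) : ℤ)
        - morseIndex (compress (S c) (star U * L d * U)) := by
  obtain ⟨U, hUc, hUu, hU1, hUP⟩ := exists_transport hcd (P := fun t => (S t).starProjection)
    (fun t => ⟨S t, inferInstance, rfl⟩) hSc
  refine ⟨U d, hUu d, hUP d ⟨hcd, le_rfl⟩, ?_⟩
  have hcl := continuous_clamp c d
  let N : FredholmPath H :=
    { toFun := fun s => star (U (clamp c d s)) * Λ s * U (clamp c d s)
      continuous_toFun := ((continuous_star_operator.comp (hUc.comp hcl)).mul
        Λ.continuous_toFun).mul (hUc.comp hcl)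
      mem_fredholmSelfAdjoint := fun s =>
        congruence_mem_fredholmSelfAdjoint (Λ.mem_fredholmSelfAdjoint s) (hUu _)
      isUnit_zero := ((hUu _).star.mul Λ.isUnit_zero).mul (hUu _)
      isUnit_one := ((hUu _).star.mul Λ.isUnit_one).mul (hUu _) }
  have h1 : μ H Λ = μ H N := by
    -- The transport is run only up to time `max c p.1`: it is `U c = 1` when `p.1 = 0`, and
    -- complete when `p.1 = 1`.
    refine invariant_eq_of_congruence hH (G := fun p => U (min (clamp c d p.2) (max c p.1))) ?_
      (fun p => hUu _) ?_ ?_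
    · exact hUc.comp ((hcl.comp continuous_snd).min (continuous_const.max continuous_fst))
    · intro s; simp [hU1, (clamp_mem hcd s).1]
    · intro s; simp [N, unitInterval.le_one']
  have hPs : ∀ t, IsStarProjection (S t).starProjection := fun t =>
    isStarProjection_starProjection
  have hNc : ∀ s, Commute (S c).starProjection (N s) := by
    intro s
    have ht := clamp_mem hcd s
    have e1 : N s = star (U (clamp c d s)) * L (clamp c d s) * U (clamp c d s) := by
      simp only [N, hΛ]
    rw [e1]
    generalize clamp c d s = t at ht
    have e2 := hUP t ht
    have e3 : (S c).starProjection * star (U t) = star (U t) * (S t).starProjection := by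
      simpa [(hPs _).isSelfAdjoint.star_eq] using congrArg star e2
    have e4 := (hcomm t ht).eq
    change (S c).starProjection * (star (U t) * L t * U t)
      = star (U t) * L t * U t * (S c).starProjection
    linear_combination (norm := noncomm_ring)
      e3 * L t * U t + star (U t) * e4 * U t - star (U t) * L t * e2
  rw [h1, invariant_eq_of_commute hZ hA hM N (S c) hNc]
  · simp only [N, hΛ]
    rw [show clamp c d 0 = c by simp [clamp], show clamp c d 1 = d by
      simp [clamp, hcd, unitInterval.le_one'], hU1]
    simp
  · intro s
    refine isUnit_complCompression _ (N.mem_fredholmSelfAdjoint s) fun v hv hNv => ?_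
    have hNv0 : N s v = 0 := by
      rw [← Submodule.starProjection_eq_self_iff.2 hNv, ← mul_apply_eq_comp, (hNc s).eq,
        mul_apply_eq_comp, hv, map_zero]
    have ht := clamp_mem hcd s
    have e1 : N s = star (U (clamp c d s)) * L (clamp c d s) * U (clamp c d s) := by
      simp only [N, hΛ]
    rw [e1] at hNv0
    generalize clamp c d s = t at ht hNv0
    have hLv : L t (U t v) = 0 := injective_of_isUnit (hUu t).star hNv0
    have hPv : (S t).starProjection (U t v) = 0 := by
      have := congrArg (fun A : H →L[ℝ] H => A v) (hUP t ht)
      simp only [mul_apply_eq_comp] at this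
      rw [← this, hv, map_zero]
    refine injective_of_isUnit (hUu t) (injective_of_isUnit (hu t ht) ?_)
    simp [complCompression, hLv, hPv]

end Invariant

/-! ### Morse index and the law of inertia -/

section FiniteDimensional

variable {H : Type u} [NormedAddCommGroup H] [InnerProductSpace ℝ H] [CompleteSpace H]

theorem exists_eigenvectors {T : H →L[ℝ] H} (hT : IsSelfAdjoint T) (F : Submodule ℝ H)
    [FiniteDimensional ℝ F] (hF : ∀ x ∈ F, T x ∈ F) :
    ∃ (n : ℕ) (c : Fin n → ℝ) (v : Fin n → H),
      (∀ i, v i ∈ F ∧ v i ≠ 0 ∧ T (v i) = c i • v i) ∧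
      ∀ x ∈ F, inner ℝ (T x) x = ∑ i, c i * inner ℝ (v i) x ^ 2 ∧
        ‖x‖ ^ 2 = ∑ i, inner ℝ (v i) x ^ 2 := by
  have hs : (T.toLinearMap.restrict hF).IsSymmetric := hT.isSymmetric.restrict_invariant hF
  set b := hs.eigenvectorBasis rfl with hb
  have hTb : ∀ i, T (b i) = hs.eigenvalues rfl i • (b i : H) := fun i =>
    congrArg Subtype.val (hs.apply_eigenvectorBasis rfl i)
  refine ⟨_, hs.eigenvalues rfl, fun i => b i, fun i => ⟨(b i).2, ?_, hTb i⟩, fun x hx => ⟨?_, ?_⟩⟩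
  · intro h
    exact b.orthonormal.ne_zero i (Subtype.ext h)
  · have h1 := b.sum_inner_mul_inner (⟨T x, hF x hx⟩ : F) ⟨x, hx⟩
    rw [Submodule.coe_inner] at h1
    change _ = inner ℝ (T x) x at h1
    rw [← h1]
    refine Finset.sum_congr rfl fun i _ => ?_
    rw [Submodule.coe_inner, Submodule.coe_inner]
    change inner ℝ (T x) (b i : H) * inner ℝ (b i : H) x = _
    rw [inner_selfAdjoint hT, hTb, inner_smul_right, real_inner_comm]
    ring
  · have h1 := b.sum_sq_norm_inner_right (⟨x, hx⟩ : F)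
    change _ = ‖x‖ ^ 2 at h1
    rw [← h1]
    refine Finset.sum_congr rfl fun i _ => ?_
    rw [Submodule.coe_inner, Real.norm_eq_abs, sq_abs]

theorem inner_nonneg_of_eigenvalues {T : H →L[ℝ] H} (hT : IsSelfAdjoint T) {F : Submodule ℝ H}
    [FiniteDimensional ℝ F] (hF : ∀ x ∈ F, T x ∈ F)
    (h : ∀ x ∈ F, x ≠ 0 → ∀ c : ℝ, T x = c • x → 0 ≤ c) {x : H} (hx : x ∈ F) :
    0 ≤ inner ℝ (T x) x := by
  obtain ⟨n, c, v, hv, hsum⟩ := exists_eigenvectors hT F hF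
  rw [(hsum x hx).1]
  exact Finset.sum_nonneg fun i _ =>
    mul_nonneg (h _ (hv i).1 (hv i).2.1 _ (hv i).2.2) (sq_nonneg _)

theorem exists_inner_le_of_eigenvalues {T : H →L[ℝ] H} (hT : IsSelfAdjoint T)
    {F : Submodule ℝ H} [FiniteDimensional ℝ F] (hF : ∀ x ∈ F, T x ∈ F)
    (h : ∀ x ∈ F, x ≠ 0 → ∀ c : ℝ, T x = c • x → c < 0) :
    ∃ κ > 0, ∀ x ∈ F, inner ℝ (T x) x ≤ -κ * ‖x‖ ^ 2 := by
  obtain ⟨n, c, v, hv, hsum⟩ := exists_eigenvectors hT F hF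
  have hc : ∀ i, c i < 0 := fun i => h _ (hv i).1 (hv i).2.1 _ (hv i).2.2
  have hev : ∀ᶠ κ in 𝓝[>] (0 : ℝ), ∀ i, κ < -c i :=
    Filter.eventually_all.2 fun i => nhdsWithin_le_nhds (eventually_lt_nhds (by linarith [hc i]))
  obtain ⟨κ, hκ, hκ0⟩ := (hev.and self_mem_nhdsWithin).exists
  refine ⟨κ, hκ0, fun x hx => ?_⟩
  rw [(hsum x hx).1, (hsum x hx).2, Finset.mul_sum]
  exact Finset.sum_le_sum fun i _ =>
    mul_le_mul_of_nonneg_right (by linarith [hκ i]) (sq_nonneg _)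

theorem orthogonal_of_eigenvalue_ne {T : H →L[ℝ] H} (hT : IsSelfAdjoint T) {x y : H} {a b : ℝ}
    (hx : T x = a • x) (hy : T y = b • y) (hab : a ≠ b) : inner ℝ x y = 0 := by
  have h := inner_selfAdjoint hT x y
  rw [hx, hy, real_inner_smul_left, inner_smul_right] at h
  have : (a - b) * inner ℝ x y = 0 := by linarith
  exact (mul_eq_zero.1 this).resolve_left (sub_ne_zero.2 hab)

/-- The Morse index is the dimension of any subspace on which the form is negative definite and
which has a complementary dimension to a subspace on which the form is nonnegative. -/
theorem morseIndex_eq_finrank [FiniteDimensional ℝ H] {T : H →L[ℝ] H} (hT : IsSelfAdjoint T)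
    {N Q : Submodule ℝ H} (hN : ∀ x ∈ N, x ≠ 0 → inner ℝ (T x) x < 0)
    (hQ : ∀ x ∈ Q, 0 ≤ inner ℝ (T x) x)
    (hdim : Module.finrank ℝ N + Module.finrank ℝ Q = Module.finrank ℝ H) :
    morseIndex T = Module.finrank ℝ N := by
  unfold morseIndex
  set W : Submodule ℝ H :=
    ⨆ c : {c : ℝ // c < 0}, Module.End.eigenspace (T : H →ₗ[ℝ] H) c.1 with hW
  have hmem : ∀ (c : ℝ), c < 0 → ∀ x, T x = c • x → x ∈ W := fun c hc x hx =>
    le_iSup (fun c : {c : ℝ // c < 0} => Module.End.eigenspace (T : H →ₗ[ℝ] H) c.1) ⟨c, hc⟩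
      (Module.End.mem_eigenspace_iff.2 hx)
  have hWinv : ∀ x ∈ W, T x ∈ W := by
    have : W ≤ W.comap (T : H →ₗ[ℝ] H) := by
      refine iSup_le fun c x hx => ?_
      have hx' : T x = c.1 • x := Module.End.mem_eigenspace_iff.1 hx
      change T x ∈ W
      rw [hx']
      exact W.smul_mem _ (hmem c.1 c.2 x hx')
    exact this
  have hWinv' : ∀ x ∈ Wᗮ, T x ∈ Wᗮ := fun x hx => by
    rw [Submodule.mem_orthogonal] at hx ⊢
    intro y hy
    rw [← inner_selfAdjoint hT]
    exact hx _ (hWinv y hy)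
  have hWneg : ∀ x ∈ W, x ≠ 0 → inner ℝ (T x) x < 0 := by
    obtain ⟨κ, hκ, h⟩ := exists_inner_le_of_eigenvalues hT hWinv (by
      intro x hx hx0 c hc
      by_contra hc0
      -- An eigenvector with nonnegative eigenvalue is orthogonal to all generators of `W`; if it
      -- lay in `W` it would be orthogonal to itself.
      have hle : W ≤ (ℝ ∙ x)ᗮ := iSup_le fun d y hy => by
        rw [Submodule.mem_orthogonal_singleton_iff_inner_right]
        exact orthogonal_of_eigenvalue_ne hT hc (Module.End.mem_eigenspace_iff.1 hy)
          (by have := d.2; intro h; linarith)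
      have := hle hx
      rw [Submodule.mem_orthogonal_singleton_iff_inner_right] at this
      exact hx0 (inner_self_eq_zero.1 this))
    intro x hx hx0
    have : 0 < ‖x‖ := norm_pos_iff.2 hx0
    have := h x hx
    have : 0 < κ * ‖x‖ ^ 2 := by positivity
    linarith
  have hWnonneg : ∀ x ∈ Wᗮ, 0 ≤ inner ℝ (T x) x := fun x hx =>
    inner_nonneg_of_eigenvalues hT hWinv' (by
      intro x hx hx0 c hc
      by_contra hc0
      have h1 := hmem c (by linarith) x hc
      exact hx0 (inner_self_eq_zero.1
        (Submodule.inner_right_of_mem_orthogonal h1 hx : inner ℝ x x = 0))) hx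
  have d1 : Disjoint W Q := Submodule.disjoint_def.2 fun x h1 h2 => by
    by_contra h0
    linarith [hWneg x h1 h0, hQ x h2]
  have d2 : Disjoint N Wᗮ := Submodule.disjoint_def.2 fun x h1 h2 => by
    by_contra h0
    linarith [hN x h1 h0, hWnonneg x h2]
  -- The two disjointness statements bound `dim W` by `dim N` and conversely, once `hdim` is
  -- inserted.
  have e1 := Submodule.finrank_add_finrank_le_of_disjoint d1
  have e2 := Submodule.finrank_add_finrank_le_of_disjoint d2
  have e3 := Submodule.finrank_add_finrank_orthogonal W
  omega

theorem finrank_comap_eq {V : Submodule ℝ H} {U : H →L[ℝ] H} (hU : IsUnit U) {F : Submodule ℝ H}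
    [V.HasOrthogonalProjection] [F.HasOrthogonalProjection]
    (hUV : U * V.starProjection = F.starProjection * U) {N : Submodule ℝ H} (hN : N ≤ F) :
    Module.finrank ℝ (N.comap (U.toLinearMap ∘ₗ V.subtype)) = Module.finrank ℝ N := by
  have hinj : Function.Injective (U.toLinearMap ∘ₗ V.subtype) :=
    (ContinuousLinearMap.isUnit_iff_bijective.1 hU).1.comp Subtype.val_injective
  have hle : N ≤ (U.toLinearMap ∘ₗ V.subtype).range := by
    intro y hy
    obtain ⟨x, hx⟩ := (ContinuousLinearMap.isUnit_iff_bijective.1 hU).2 y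
    have h1 : U (V.starProjection x) = F.starProjection (U x) :=
      congrArg (fun A : H →L[ℝ] H => A x) hUV
    rw [hx, Submodule.starProjection_eq_self_iff.2 (hN hy), ← hx] at h1
    have h2 := (ContinuousLinearMap.isUnit_iff_bijective.1 hU).1 h1
    exact ⟨⟨x, Submodule.starProjection_eq_self_iff.1 h2⟩, hx⟩
  rw [(Submodule.equivMapOfInjective _ hinj _).finrank_eq, Submodule.map_comap_eq_of_le hle]

theorem finrank_eq_of_intertwined {V F : Submodule ℝ H} {U : H →L[ℝ] H} (hU : IsUnit U)
    [V.HasOrthogonalProjection] [F.HasOrthogonalProjection]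
    (hUV : U * V.starProjection = F.starProjection * U) :
    Module.finrank ℝ V = Module.finrank ℝ F := by
  rw [← finrank_comap_eq hU hUV le_rfl]
  have : F.comap (U.toLinearMap ∘ₗ V.subtype) = ⊤ := by
    rw [eq_top_iff]
    intro x _
    change U x ∈ F
    have h1 : U (V.starProjection x) = F.starProjection (U x) :=
      congrArg (fun A : H →L[ℝ] H => A x) hUV
    rw [Submodule.starProjection_eq_self_iff.2 x.2] at h1
    exact Submodule.starProjection_eq_self_iff.1 h1.symm
  rw [this, finrank_top]

theorem morseIndex_compress_congruence {T : H →L[ℝ] H} (hT : IsSelfAdjoint T)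
    {V F : Submodule ℝ H} [FiniteDimensional ℝ V] [FiniteDimensional ℝ F] {U : H →L[ℝ] H}
    (hU : IsUnit U) (hUV : U * V.starProjection = F.starProjection * U) {N Q : Submodule ℝ H}
    (hNF : N ≤ F) (hQF : Q ≤ F) (hN : ∀ x ∈ N, x ≠ 0 → inner ℝ (T x) x < 0)
    (hQ : ∀ x ∈ Q, 0 ≤ inner ℝ (T x) x)
    (hdim : Module.finrank ℝ N + Module.finrank ℝ Q = Module.finrank ℝ F) :
    morseIndex (compress V (star U * T * U)) = Module.finrank ℝ N := by
  have hform : ∀ x : V, inner ℝ (compress V (star U * T * U) x) x = inner ℝ (T (U x)) (U x) := by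
    intro x
    rw [inner_compress]
    change inner ℝ ((ContinuousLinearMap.adjoint U) (T (U x))) (x : H) = _
    rw [ContinuousLinearMap.adjoint_inner_left]
  have hV : Module.finrank ℝ V = Module.finrank ℝ F := finrank_eq_of_intertwined hU hUV
  rw [← finrank_comap_eq hU hUV hNF]
  refine morseIndex_eq_finrank (isSelfAdjoint_compress V (isSelfAdjoint_congruence hT U))
    (Q := Q.comap (U.toLinearMap ∘ₗ V.subtype)) ?_ ?_ ?_
  · intro x hx hx0
    rw [hform]
    refine hN _ hx fun h => hx0 (Subtype.ext (injective_of_isUnit hU h))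
  · intro x hx
    rw [hform]
    exact hQ _ hx
  · rw [finrank_comap_eq hU hUV hNF, finrank_comap_eq hU hUV hQF, hV, hdim]

end FiniteDimensional

/-! ### Eigenvalues and dimensions of spectral subspaces -/

section SpectralSubspaces

variable {H : Type u} [NormedAddCommGroup H] [InnerProductSpace ℝ H] [CompleteSpace H]

theorem le_spectralSubspace {T : H →L[ℝ] H} {a b : ℝ} {M : Submodule ℝ H}
    (h1 : ∀ x ∈ M, T x ∈ M)
    (h2 : ∀ x ∈ M, a * ‖x‖ ^ 2 ≤ inner ℝ (T x) x ∧ inner ℝ (T x) x ≤ b * ‖x‖ ^ 2) :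
    M ≤ spectralSubspace T a b :=
  (le_sSup (show M ∈ {M : Submodule ℝ H | (∀ x ∈ M, T x ∈ M) ∧ ∀ x ∈ M,
    a * ‖x‖ ^ 2 ≤ inner ℝ (T x) x ∧ inner ℝ (T x) x ≤ b * ‖x‖ ^ 2} from ⟨h1, h2⟩)).trans
    (Submodule.le_topologicalClosure _)

theorem spectralSubspace_le {T : H →L[ℝ] H} {a b : ℝ} {F : Submodule ℝ H}
    (hF : IsClosed (F : Set H)) (h : ∀ M : Submodule ℝ H, (∀ x ∈ M, T x ∈ M) →
      (∀ x ∈ M, a * ‖x‖ ^ 2 ≤ inner ℝ (T x) x ∧ inner ℝ (T x) x ≤ b * ‖x‖ ^ 2) → M ≤ F) :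
    spectralSubspace T a b ≤ F :=
  Submodule.topologicalClosure_minimal _ (sSup_le fun M hM => h M hM.1 hM.2) hF

theorem map_mem_spectralSubspace {T : H →L[ℝ] H} {a b : ℝ} :
    ∀ x ∈ spectralSubspace T a b, T x ∈ spectralSubspace T a b := by
  have hcl : IsClosed (spectralSubspace T a b : Set H) := Submodule.isClosed_topologicalClosure _
  have : spectralSubspace T a b ≤ (spectralSubspace T a b).comap T.toLinearMap :=
    spectralSubspace_le (hcl.preimage T.continuous) fun M h1 h2 x hx =>
      le_spectralSubspace h1 h2 (h1 x hx)
  exact this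

theorem commute_starProjection {T : H →L[ℝ] H} (hT : IsSelfAdjoint T) {F : Submodule ℝ H}
    [F.HasOrthogonalProjection] (hF : ∀ x ∈ F, T x ∈ F) : Commute F.starProjection T := by
  refine commute_of_compl_mul_mul_eq_zero isStarProjection_starProjection hT ?_
  ext x
  change T (F.starProjection x) - F.starProjection (T (F.starProjection x)) = 0
  rw [Submodule.starProjection_eq_self_iff.2 (hF _ (Submodule.starProjection_apply_mem F x)),
    sub_self]

/-- The form bounds are given only on the subspaces `M` generating the spectral subspace, so the
eigenvector is projected to each of them. The projection has the same eigenvalue; if `c` is outside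
`[a, b]` it vanishes for every `M`, and `x` is orthogonal to itself. -/
theorem eigenvalue_mem_of_mem_spectralSubspace {T : H →L[ℝ] H} (hT : IsSelfAdjoint T) {a b : ℝ}
    [FiniteDimensional ℝ (spectralSubspace T a b)] {x : H} (hx : x ∈ spectralSubspace T a b)
    (hx0 : x ≠ 0) {c : ℝ} (hc : T x = c • x) : a ≤ c ∧ c ≤ b := by
  by_contra hcon
  have hle : spectralSubspace T a b ≤ (ℝ ∙ x)ᗮ := by
    refine spectralSubspace_le (Submodule.isClosed_orthogonal _) fun M h1 h2 y hy => ?_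
    have := Submodule.finiteDimensional_of_le (le_spectralSubspace h1 h2)
    set p := M.starProjection x with hp
    have hpM : p ∈ M := Submodule.starProjection_apply_mem M x
    have hTp : T p = c • p := by
      rw [hp, ← mul_apply_eq_comp, ← (commute_starProjection hT h1).eq, mul_apply_eq_comp, hc,
        map_smul]
    have h3 := h2 p hpM
    rw [hTp, real_inner_smul_left, real_inner_self_eq_norm_sq] at h3
    have hp0 : p = 0 := by
      by_contra hne
      have : 0 < ‖p‖ ^ 2 := by have := norm_pos_iff.2 hne; positivity
      exact hcon ⟨le_of_mul_le_mul_right h3.1 this, le_of_mul_le_mul_right h3.2 this⟩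
    rw [Submodule.mem_orthogonal_singleton_iff_inner_right]
    have hxM : x ∈ Mᗮ := (Submodule.starProjection_apply_eq_zero_iff _).1 hp0
    exact Submodule.inner_left_of_mem_orthogonal hy hxM
  have := hle hx
  rw [Submodule.mem_orthogonal_singleton_iff_inner_right] at this
  exact hx0 (inner_self_eq_zero.1 this)

theorem mem_spectralSubspace_of_eigenvector {T : H →L[ℝ] H} {a b c : ℝ} {x : H}
    (hc : T x = c • x) (ha : a ≤ c) (hb : c ≤ b) : x ∈ spectralSubspace T a b := by
  refine le_spectralSubspace (M := ℝ ∙ x) ?_ ?_ (Submodule.mem_span_singleton_self x)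
  · intro y hy
    obtain ⟨r, rfl⟩ := Submodule.mem_span_singleton.1 hy
    rw [map_smul, hc, smul_comm]
    exact Submodule.smul_mem _ _ hy
  · intro y hy
    obtain ⟨r, rfl⟩ := Submodule.mem_span_singleton.1 hy
    have : T (r • x) = c • (r • x) := by rw [map_smul, hc, smul_comm]
    rw [this, real_inner_smul_left, real_inner_self_eq_norm_sq]
    exact ⟨by gcongr, by gcongr⟩

theorem spectralSubspace_mono {T : H →L[ℝ] H} {a a' b : ℝ} (h : a ≤ a') :
    spectralSubspace T a' b ≤ spectralSubspace T a b :=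
  spectralSubspace_le (Submodule.isClosed_topologicalClosure _) fun M h1 h2 =>
    le_spectralSubspace h1 fun x hx =>
      ⟨(mul_le_mul_of_nonneg_right h (by positivity)).trans (h2 x hx).1, (h2 x hx).2⟩

theorem isUnit_complCompression_spectralSubspace {T : H →L[ℝ] H}
    (hT : T ∈ fredholmSelfAdjoint H) {a : ℝ} (ha : 0 < a)
    [FiniteDimensional ℝ (spectralSubspace T (-a) a)] :
    IsUnit (complCompression (spectralSubspace T (-a) a).starProjection T) := by
  refine isUnit_complCompression _ hT fun v hv hTv => ?_
  have h1 : T v = 0 := by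
    rw [← Submodule.starProjection_eq_self_iff.2 hTv, ← mul_apply_eq_comp,
      (commute_starProjection hT.1 map_mem_spectralSubspace).eq, mul_apply_eq_comp, hv, map_zero]
  have h2 : v ∈ spectralSubspace T (-a) a :=
    mem_spectralSubspace_of_eigenvector (c := 0) (by simpa using h1) (by linarith) ha.le
  rw [← Submodule.starProjection_eq_self_iff.2 h2, hv]

/-- The complement of `E(T, [0, a])` in `E(T, [-a, a])` has only negative eigenvalues, because an
eigenvector with eigenvalue in `[0, a]` already lies in the former. -/
theorem exists_negative_complement {T : H →L[ℝ] H} (hT : IsSelfAdjoint T) {a : ℝ} (ha : 0 < a)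
    [FiniteDimensional ℝ (spectralSubspace T (-a) a)] :
    (∀ x ∈ spectralSubspace T 0 a, 0 ≤ inner ℝ (T x) x) ∧
    ∃ N ≤ spectralSubspace T (-a) a,
      Module.finrank ℝ N + Module.finrank ℝ (spectralSubspace T 0 a)
        = Module.finrank ℝ (spectralSubspace T (-a) a) ∧
      ∃ κ > 0, ∀ x ∈ N, inner ℝ (T x) x ≤ -κ * ‖x‖ ^ 2 := by
  have hle : spectralSubspace T 0 a ≤ spectralSubspace T (-a) a :=
    spectralSubspace_mono (by linarith)
  have hfin := Submodule.finiteDimensional_of_le hle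
  refine ⟨fun x hx => inner_nonneg_of_eigenvalues hT map_mem_spectralSubspace
    (fun y hy hy0 c hc => (eigenvalue_mem_of_mem_spectralSubspace hT hy hy0 hc).1) hx,
    (spectralSubspace T 0 a)ᗮ ⊓ spectralSubspace T (-a) a, inf_le_right, ?_, ?_⟩
  · rw [add_comm]
    exact Submodule.finrank_add_inf_finrank_orthogonal hle
  · have := Submodule.finiteDimensional_of_le
      (inf_le_right : (spectralSubspace T 0 a)ᗮ ⊓ spectralSubspace T (-a) a ≤ _)
    refine exists_inner_le_of_eigenvalues hT ?_ ?_
    · rintro x ⟨hx1, hx2⟩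
      refine ⟨?_, map_mem_spectralSubspace x hx2⟩
      refine (Submodule.mem_orthogonal _ _).2 fun y hy => ?_
      rw [← inner_selfAdjoint hT]
      exact (Submodule.mem_orthogonal _ _).1 hx1 _ (map_mem_spectralSubspace y hy)
    · rintro x ⟨hx1, hx2⟩ hx0 c hc
      by_contra hc0
      have h1 := (eigenvalue_mem_of_mem_spectralSubspace hT hx2 hx0 hc).2
      have h2 : x ∈ spectralSubspace T 0 a :=
        mem_spectralSubspace_of_eigenvector hc (by linarith) h1
      exact hx0 (inner_self_eq_zero.1
        (Submodule.inner_right_of_mem_orthogonal h2 hx1 : inner ℝ x x = 0))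

/-- A shift smaller than `κ` keeps the form negative on the complement of `E(T, [0, a])`, and
nonnegative on the latter. The estimate is uniform in `V` and `U`, since the transport `U` is
produced only after `ε` is fixed. -/
theorem eventually_morseIndex_eq {T : H →L[ℝ] H} (hT : IsSelfAdjoint T) {a : ℝ} (ha : 0 < a)
    [FiniteDimensional ℝ (spectralSubspace T (-a) a)] :
    ∀ᶠ ε in 𝓝[>] (0 : ℝ), ∀ (V : Submodule ℝ H) [FiniteDimensional ℝ V] (U : H →L[ℝ] H),
      IsUnit U → U * V.starProjection = (spectralSubspace T (-a) a).starProjection * U →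
      (morseIndex (compress V (star U * (T + ε • (1 : H →L[ℝ] H)) * U)) : ℤ)
        = Module.finrank ℝ V - Module.finrank ℝ (spectralSubspace T 0 a) := by
  obtain ⟨hQ, N, hN, hdim, κ, hκ, hneg⟩ := exists_negative_complement hT ha
  filter_upwards [Ioo_mem_nhdsGT hκ] with ε hε V _ U hU hUV
  have hform : ∀ x, inner ℝ ((T + ε • (1 : H →L[ℝ] H)) x) x = inner ℝ (T x) x + ε * ‖x‖ ^ 2 := by
    intro x
    simp [inner_add_left, real_inner_smul_left]
  have h1 := morseIndex_compress_congruence (T := T + ε • (1 : H →L[ℝ] H))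
    (hT.add (IsSelfAdjoint.smul (IsSelfAdjoint.all ε) (IsSelfAdjoint.one _))) hU hUV hN
    (spectralSubspace_mono (by linarith)) (fun x hx hx0 => by
      rw [hform]
      have : 0 < ‖x‖ := norm_pos_iff.2 hx0
      have h2 := hneg x hx
      have h3 : 0 < (κ - ε) * ‖x‖ ^ 2 := mul_pos (by linarith [hε.2]) (by positivity)
      linarith) (fun x hx => by
      rw [hform]
      have := hε.1
      have := hQ x hx
      positivity) hdim
  have hV : Module.finrank ℝ V = Module.finrank ℝ (spectralSubspace T (-a) a) :=
    finrank_eq_of_intertwined hU hUV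
  rw [h1, hV]
  omega

end SpectralSubspaces

/-! ### The invariant equals the value of a partition -/

section Value

variable {μ : PathInvariant.{u}}
variable {H : Type u} [NormedAddCommGroup H] [InnerProductSpace ℝ H] [CompleteSpace H]

theorem isSelfAdjoint_smul_one (ε : ℝ) : IsSelfAdjoint (ε • (1 : H →L[ℝ] H)) :=
  IsSelfAdjoint.smul (IsSelfAdjoint.all ε) (IsSelfAdjoint.one _)

/-- The shift changes the completed block by `ε` times a projection, and invertibility on a compact
set survives uniformly small changes. -/
theorem eventually_isUnit_complCompression_add {L : unitInterval → H →L[ℝ] H} {s : Set unitInterval}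
    (hs : IsCompact s) (hL : ContinuousOn L s) (S : unitInterval → Submodule ℝ H)
    [∀ t, (S t).HasOrthogonalProjection]
    (hS : ContinuousOn (fun t => (S t).starProjection) s)
    (hu : ∀ t ∈ s, IsUnit (complCompression (S t).starProjection (L t))) :
    ∀ᶠ ε in 𝓝[>] (0 : ℝ), ∀ t ∈ s,
      IsUnit (complCompression (S t).starProjection (L t + ε • (1 : H →L[ℝ] H))) := by
  obtain ⟨δ, hδ, h⟩ := exists_pos_isUnit_add hs
    (f := fun t => complCompression (S t).starProjection (L t))
    ((((continuousOn_const.sub hS).mul hL).mul (continuousOn_const.sub hS)).add hS) hu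
  filter_upwards [Ioo_mem_nhdsGT hδ] with ε hε t ht
  have hP := (isStarProjection_starProjection (U := S t)).isIdempotentElem.eq
  have e : complCompression (S t).starProjection (L t + ε • (1 : H →L[ℝ] H))
      = complCompression (S t).starProjection (L t) + ε • (S t)ᗮ.starProjection := by
    rw [Submodule.starProjection_orthogonal']
    have : (1 - (S t).starProjection) * (1 - (S t).starProjection) = 1 - (S t).starProjection := by
      linear_combination (norm := noncomm_ring) hP
    unfold complCompression
    rw [mul_add, add_mul, mul_smul_comm, smul_mul_assoc, mul_one, this]
    abel
  rw [e]
  refine h t ht _ ?_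
  rw [norm_smul, Real.norm_of_nonneg hε.1.le]
  exact (mul_le_of_le_one_right hε.1.le (S t)ᗮ.starProjection_norm_le).trans_lt hε.2

/-- Shifting a path by a small positive multiple of the identity does not change its invariant. -/
theorem eventually_exists_shift [SeparableSpace H] (hH : HomotopyProperty μ) (L : FredholmPath H) :
    ∀ᶠ ε in 𝓝[>] (0 : ℝ), ∃ L' : FredholmPath H,
      (∀ s, L' s = L s + ε • (1 : H →L[ℝ] H)) ∧ μ H L = μ H L' := by
  obtain ⟨δ₁, hδ₁, h₁⟩ :=
    exists_pos_add_mem_fredholmSelfAdjoint L.continuous_toFun L.mem_fredholmSelfAdjoint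
  obtain ⟨δ₂, hδ₂, h₂⟩ := exists_pos_isUnit_add (s := {0, 1}) (f := L)
    (Set.toFinite _).isCompact L.continuous_toFun.continuousOn (by
      rintro x (rfl | rfl)
      exacts [L.isUnit_zero, L.isUnit_one])
  filter_upwards [Ioo_mem_nhdsGT hδ₁, Ioo_mem_nhdsGT hδ₂] with ε hε₁ hε₂
  have hn : ∀ r : unitInterval, ‖((r : ℝ) * ε) • (1 : H →L[ℝ] H)‖ ≤ ε := fun r => by
    refine (norm_smul_one_le _).trans ?_
    rw [abs_of_nonneg (mul_nonneg r.2.1 hε₁.1.le)]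
    exact mul_le_of_le_one_left hε₁.1.le r.2.2
  have hF : ∀ r s : unitInterval, L s + ((r : ℝ) * ε) • (1 : H →L[ℝ] H) ∈ fredholmSelfAdjoint H :=
    fun r s => h₁ s _ (isSelfAdjoint_smul_one _) ((hn r).trans_lt hε₁.2)
  have hU0 : ∀ r : unitInterval, IsUnit (L 0 + ((r : ℝ) * ε) • (1 : H →L[ℝ] H)) :=
    fun r => h₂ 0 (by simp) _ ((hn r).trans_lt hε₂.2)
  have hU1 : ∀ r : unitInterval, IsUnit (L 1 + ((r : ℝ) * ε) • (1 : H →L[ℝ] H)) :=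
    fun r => h₂ 1 (by simp) _ ((hn r).trans_lt hε₂.2)
  refine ⟨{ toFun := fun s => L s + ε • (1 : H →L[ℝ] H)
            continuous_toFun := L.continuous_toFun.add continuous_const
            mem_fredholmSelfAdjoint := fun s => by simpa using hF 1 s
            isUnit_zero := by simpa using hU0 1
            isUnit_one := by simpa using hU1 1 }, fun s => rfl, ?_⟩
  refine hH H (fun p => L p.2 + ((p.1 : ℝ) * ε) • (1 : H →L[ℝ] H)) ?_ (fun p => hF _ _)
    (fun s => ⟨hU0 s, hU1 s⟩) _ _ (fun t => by simp) (fun t => by simp)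
  exact (L.continuous_toFun.comp continuous_snd).add
    (((continuous_subtype_val.comp continuous_fst).mul continuous_const).smul continuous_const)

theorem sum_sub_telescope {N : ℕ} (f : Fin (N + 1) → ℤ) :
    ∑ i : Fin N, (f i.castSucc - f i.succ) = f 0 - f (Fin.last N) := by
  have h1 := Fin.sum_univ_castSucc f
  have h2 := Fin.sum_univ_succ f
  rw [Finset.sum_sub_distrib]
  linarith

theorem invariant_eq_value [SeparableSpace H] (hZ : ZeroProperty μ) (hA : AdditivityProperty μ)
    (hH : HomotopyProperty μ) (hM : MorseProperty μ) (L : FredholmPath H)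
    (D : SpectralPartition L) : μ H L = D.value := by
  have hle : ∀ i : Fin D.N, D.t i.castSucc ≤ D.t i.succ := fun i =>
    (D.strictMono_t i.castSucc_lt_succ).le
  have hsa := fun t => (L.mem_fredholmSelfAdjoint t).1
  have hfl : ∀ i : Fin D.N,
      FiniteDimensional ℝ (spectralSubspace (L (D.t i.castSucc)) (-D.a i) (D.a i)) :=
    fun i => D.finite_rank i _ ⟨le_rfl, hle i⟩
  have hfr : ∀ i : Fin D.N,
      FiniteDimensional ℝ (spectralSubspace (L (D.t i.succ)) (-D.a i) (D.a i)) :=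
    fun i => D.finite_rank i _ ⟨hle i, le_rfl⟩
  have ev1 : ∀ᶠ ε in 𝓝[>] (0 : ℝ), ∀ j, IsUnit (L (D.t j) + ε • (1 : H →L[ℝ] H)) :=
    Filter.eventually_all.2 fun j => by
      obtain ⟨δ, hδ, h⟩ := exists_pos_isUnit_add_smul_one (L.mem_fredholmSelfAdjoint (D.t j))
      filter_upwards [Ioo_mem_nhdsGT hδ] with ε hε using h ε hε.1 hε.2
  have ev2 : ∀ᶠ ε in 𝓝[>] (0 : ℝ), ∀ i : Fin D.N, ∀ t ∈ Set.Icc (D.t i.castSucc) (D.t i.succ),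
      IsUnit (complCompression (spectralSubspace (L t) (-D.a i) (D.a i)).starProjection
        (L t + ε • (1 : H →L[ℝ] H))) :=
    Filter.eventually_all.2 fun i =>
      eventually_isUnit_complCompression_add isCompact_Icc L.continuous_toFun.continuousOn
        (fun t => spectralSubspace (L t) (-D.a i) (D.a i)) (D.continuousOn_projection i)
        fun t ht => by
          have := D.finite_rank i t ht
          exact isUnit_complCompression_spectralSubspace (L.mem_fredholmSelfAdjoint t) (D.a_pos i)
  have ev3 := Filter.eventually_all.2 fun i : Fin D.N =>
    have := hfl i
    eventually_morseIndex_eq (hsa (D.t i.castSucc)) (D.a_pos i)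
  have ev4 := Filter.eventually_all.2 fun i : Fin D.N =>
    have := hfr i
    eventually_morseIndex_eq (hsa (D.t i.succ)) (D.a_pos i)
  -- Finitely many conditions hold for all small `ε > 0`, so one shift serves all partition points
  -- and pieces.
  obtain ⟨ε, h1, h2, h3, h4, L', hL', hμ⟩ :=
    (ev1.and (ev2.and (ev3.and (ev4.and (eventually_exists_shift hH L))))).exists
  obtain ⟨m, hm⟩ := exists_relative_index hZ hA hH hM L'
  have hpiece : ∀ i : Fin D.N, m (D.t i.castSucc) - m (D.t i.succ)
      = (Module.finrank ℝ (spectralSubspace (L (D.t i.succ)) 0 (D.a i)) : ℤ)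
        - Module.finrank ℝ (spectralSubspace (L (D.t i.castSucc)) 0 (D.a i)) := by
    intro i
    have := hfl i
    have hcl := continuous_clamp (D.t i.castSucc) (D.t i.succ)
    let Λ : FredholmPath H :=
      { toFun := fun s => L' (clamp (D.t i.castSucc) (D.t i.succ) s)
        continuous_toFun := L'.continuous_toFun.comp hcl
        mem_fredholmSelfAdjoint := fun s => L'.mem_fredholmSelfAdjoint _
        isUnit_zero := by
          rw [show clamp (D.t i.castSucc) (D.t i.succ) 0 = D.t i.castSucc by simp [clamp], hL']
          exact h1 _
        isUnit_one := by
          rw [show clamp (D.t i.castSucc) (D.t i.succ) 1 = D.t i.succ by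
            simp [clamp, hle i, unitInterval.le_one'], hL']
          exact h1 _ }
    -- The projections are those of the unshifted path; they still commute with `L' t`, which
    -- differs from `L t` by a scalar.
    obtain ⟨U, hU, hUP, hval⟩ := invariant_eq_of_projections hZ hA hH hM (hle i) Λ
      (L := L') (fun s => rfl) (fun t => spectralSubspace (L t) (-D.a i) (D.a i))
      (D.continuousOn_projection i) (fun t ht => by
        rw [hL']
        exact (commute_starProjection (hsa t) map_mem_spectralSubspace).add_right
          ((Commute.one_right _).smul_right ε)) (fun t ht => by
        rw [hL']; exact h2 i t ht)
    rw [← hm _ _ (hle i) Λ (fun s => rfl), hval]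
    have e1 := h3 i (spectralSubspace (L (D.t i.castSucc)) (-D.a i) (D.a i)) 1 isUnit_one (by simp)
    have e2 := h4 i (spectralSubspace (L (D.t i.castSucc)) (-D.a i) (D.a i)) U hU hUP
    simp only [star_one, one_mul, mul_one] at e1
    rw [hL', hL', e1, e2]
    ring
  have hclid : ∀ s : unitInterval, clamp 0 1 s = s := fun s => clamp_of_mem ⟨s.2.1, s.2.2⟩
  rw [hμ, hm 0 1 zero_le_one L' (fun s => by rw [hclid]), SpectralPartition.value,
    ← Finset.sum_congr rfl (fun i _ => hpiece i), sum_sub_telescope (fun j => m (D.t j)),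
    D.t_zero, D.t_last]

end Value

/-! ### Invariant graphs from the Riccati equation -/

section InvariantGraph

variable {R : Type*} [NormedRing R] [NormedAlgebra ℝ R] [CompleteSpace R]

/-- Near an operator `T₀` that is decoupled by the projection `Q` there are operators `Y` whose
graphs over the range of `Q` are invariant, by the implicit function theorem applied to the
Riccati equation. -/
theorem eventually_exists_invariant_graph {Q T₀ : R} (hQ : Q * Q = Q) (hT₀Q : T₀ * Q = 0)
    (hQT₀ : Q * T₀ = 0) (hu : IsUnit (T₀ + Q)) :
    ∃ Y : R → R, Y T₀ = 0 ∧ ∀ᶠ T in 𝓝 T₀, ContinuousAt Y T ∧ Q * Y T = 0 ∧ Y T * (1 - Q) = 0 ∧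
      (1 - Q) * T * (Q + Y T) = Y T * (Q * T * (Q + Y T)) := by
  have hS₀ : complCompression Q T₀ = T₀ + Q := by
    unfold complCompression
    linear_combination (norm := noncomm_ring) Q * hT₀Q - hQT₀ - hT₀Q
  -- Completing the block by `Q` makes the derivative in the second variable left multiplication by
  -- the invertible `T₀ + Q`. The Riccati equation is thus solved in all of `R`, and the
  -- off-diagonal shape of the solution must be recovered afterwards.
  let f : R × R → R := fun p => (1 - Q) * p.1 * Q + complCompression Q p.1 * p.2
    - p.2 * (Q * p.1 * Q) - p.2 * (Q * p.1 * (1 - Q)) * p.2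
  have hf : ContDiff ℝ 1 f := by
    simp only [f, complCompression]; fun_prop
  have hfd : fderiv ℝ f (T₀, 0) ∘L ContinuousLinearMap.inr ℝ R R
      = ContinuousLinearMap.mul ℝ R (T₀ + Q) := by
    have h1 : HasFDerivAt (fun y => f (T₀, y))
        (fderiv ℝ f (T₀, 0) ∘L ContinuousLinearMap.inr ℝ R R) 0 :=
      HasFDerivAt.comp (g := f) (0 : R)
        ((hf.differentiable one_ne_zero (T₀, 0)).hasFDerivAt) (hasFDerivAt_prodMk_right T₀ 0)
    have h2 : (fun y => f (T₀, y)) = ContinuousLinearMap.mul ℝ R (T₀ + Q) := by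
      funext y
      simp only [f, hS₀, ContinuousLinearMap.mul_apply']
      linear_combination (norm := noncomm_ring)
        hT₀Q - Q * hT₀Q - y * Q * hT₀Q - y * hQT₀ * (1 - Q) * y
    rw [h2] at h1
    exact h1.unique (ContinuousLinearMap.hasFDerivAt _)
  have hinv : (fderiv ℝ f (T₀, 0) ∘L ContinuousLinearMap.inr ℝ R R).IsInvertible := by
    rw [hfd]
    obtain ⟨v, hv⟩ := hu
    refine ContinuousLinearMap.IsInvertible.of_inverse
      (g := ContinuousLinearMap.mul ℝ R (↑v⁻¹ : R)) ?_ ?_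
    · ext y; simp [← hv]
    · ext y; simp [← hv]
  have hcd : ContDiffAt ℝ 1 f (T₀, 0) := hf.contDiffAt
  set Y := hcd.implicitFunction one_ne_zero hinv with hY
  have hY0 : Y T₀ = 0 := hcd.implicitFunction_apply_self one_ne_zero hinv
  have hYc : ContDiffAt ℝ 1 Y T₀ := hcd.contDiffAt_implicitFunction one_ne_zero hinv
  refine ⟨Y, hY0, ?_⟩
  have hf0 : f (T₀, 0) = 0 := by
    simp only [f]
    linear_combination (norm := noncomm_ring) hT₀Q - Q * hT₀Q
  have ev1 : ∀ᶠ T in 𝓝 T₀, f (T, Y T) = 0 := by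
    have := hcd.eventually_apply_implicitFunction one_ne_zero hinv
    rwa [hf0] at this
  have ev2 : ∀ᶠ T in 𝓝 T₀, ContinuousAt Y T :=
    (hYc.eventually (by simp)).mono fun T h => h.continuousAt
  have ev3 : ∀ᶠ T in 𝓝 T₀, IsUnit (1 - Q * T * Q - Q * T * (1 - Q) * Y T) := by
    have hc : ContinuousAt (fun T => 1 - Q * T * Q - Q * T * (1 - Q) * Y T) T₀ := by
      have := hYc.continuousAt
      fun_prop
    refine hc.eventually ((Units.isOpen (R := R)).mem_nhds ?_)
    have : 1 - Q * T₀ * Q - Q * T₀ * (1 - Q) * Y T₀ = 1 := by rw [hY0, hQT₀]; simp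
    change IsUnit (1 - Q * T₀ * Q - Q * T₀ * (1 - Q) * Y T₀)
    rw [this]; exact isUnit_one
  have ev4 : ∀ᶠ T in 𝓝 T₀, IsUnit (complCompression Q T - Y T * (Q * T * (1 - Q))) := by
    have hc : ContinuousAt (fun T => complCompression Q T - Y T * (Q * T * (1 - Q))) T₀ := by
      have := hYc.continuousAt
      have := (continuous_complCompression Q).continuousAt (x := T₀)
      fun_prop
    refine hc.eventually ((Units.isOpen (R := R)).mem_nhds ?_)
    have : complCompression Q T₀ - Y T₀ * (Q * T₀ * (1 - Q)) = T₀ + Q := by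
      rw [hY0, hS₀]; simp
    change IsUnit (complCompression Q T₀ - Y T₀ * (Q * T₀ * (1 - Q)))
    rw [this]; exact hu
  filter_upwards [ev1, ev2, ev3, ev4] with T h1 h2 h3 h4
  simp only [f, complCompression] at h1
  unfold complCompression at h4
  generalize Y T = y at h1 h3 h4
  -- Multiplying the equation by `Q` on the left gives `Q * y` times a factor close to `1`; for
  -- `e2`, multiplying by `1 - Q` on the right gives a unit times `y * (1 - Q)`.
  have e1 : Q * y = 0 := by
    have : Q * y * (1 - Q * T * Q - Q * T * (1 - Q) * y) = 0 := by
      linear_combination (norm := noncomm_ring)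
        Q * h1 + hQ * (T * Q) + hQ * T * (1 - Q) * y - hQ * y
    rwa [h3.mul_left_eq_zero] at this
  have e2 : y * (1 - Q) = 0 := by
    have : ((1 - Q) * T * (1 - Q) + Q - y * (Q * T * (1 - Q))) * (y * (1 - Q)) = 0 := by
      linear_combination (norm := noncomm_ring)
        h1 * (1 - Q) + (1 - Q) * T * hQ - y * Q * T * hQ
    rwa [h4.mul_right_eq_zero] at this
  refine ⟨h2, e1, e2, ?_⟩
  linear_combination (norm := noncomm_ring) h1 + (1 - Q) * T * e1 - y * Q * T * e1 - e1

end InvariantGraph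

/-! ### Continuity of spectral projections and existence of partitions -/

section InvariantSubspace

variable {H : Type u} [NormedAddCommGroup H] [InnerProductSpace ℝ H] [CompleteSpace H]

/-- `G = 1 + Y - star Y` maps `ker T₀` onto the graph of `Y` and the complement of `ker T₀` onto the
orthogonal complement of that graph. Hence `G Q G⁻¹` is an orthogonal projection, continuous in `T`;
the Riccati equation makes its range invariant. -/
theorem eventually_exists_invariant_subspace {T₀ : H →L[ℝ] H} (hT₀ : T₀ ∈ fredholmSelfAdjoint H)
    [FiniteDimensional ℝ T₀.ker] :
    ∃ P : (H →L[ℝ] H) → (H →L[ℝ] H), P T₀ = T₀.ker.starProjection ∧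
      ∀ᶠ T in 𝓝 T₀, ContinuousAt P T ∧ ∃ (F : Submodule ℝ H) (_ : FiniteDimensional ℝ F),
        P T = F.starProjection ∧ ∀ x ∈ F, T x ∈ F := by
  set Q : H →L[ℝ] H := T₀.ker.starProjection with hQdef
  have hQ : IsStarProjection Q := isStarProjection_starProjection
  have hQi := hQ.isIdempotentElem.eq
  have hT₀Q : T₀ * Q = 0 := by
    ext x
    exact Submodule.starProjection_apply_mem T₀.ker x
  have hQT₀ : Q * T₀ = 0 := by
    simpa [hQ.isSelfAdjoint.star_eq, hT₀.1.star_eq] using congrArg star hT₀Q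
  obtain ⟨Y, hY0, hY⟩ :=
    eventually_exists_invariant_graph hQi hT₀Q hQT₀ (isUnit_add_starProjection_ker hT₀)
  have hGc : ∀ T, ContinuousAt Y T → ContinuousAt (fun T => 1 + Y T - star (Y T)) T := fun T h =>
    (continuousAt_const.add h).sub
      (ContinuousAt.comp (g := star) continuous_star_operator.continuousAt h)
  have hG0 : 1 + Y T₀ - star (Y T₀) = 1 := by simp [hY0]
  have hGu : ∀ᶠ T in 𝓝 T₀, IsUnit (1 + Y T - star (Y T)) :=
    (hGc T₀ hY.self_of_nhds.1).eventually
      ((Units.isOpen (R := H →L[ℝ] H)).mem_nhds (by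
        change IsUnit (1 + Y T₀ - star (Y T₀))
        rw [hG0]; exact isUnit_one))
  refine ⟨fun T => (1 + Y T - star (Y T)) * Q * Ring.inverse (1 + Y T - star (Y T)), ?_, ?_⟩
  · simp only [hG0]; simp
  filter_upwards [hY, hGu] with T hT hGT
  obtain ⟨hYc, hQY, hYQ, hR⟩ := hT
  refine ⟨?_, ?_⟩
  · refine ((hGc T hYc).mul continuousAt_const).mul ?_
    exact ContinuousAt.comp (g := Ring.inverse) (continuousAt_inverse hGT) (hGc T hYc)
  set y := Y T with hy
  set G := 1 + y - star y with hG
  have hGW : G * Ring.inverse G = 1 := Ring.mul_inverse_cancel _ hGT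
  set W := Ring.inverse G with hW
  have hyQ : star y * Q = 0 := by
    simpa [hQ.isSelfAdjoint.star_eq] using congrArg star hQY
  have hQy : (1 - Q) * star y = 0 := by
    simpa [hQ.isSelfAdjoint.star_eq] using congrArg star hYQ
  have hyy : star y * star y = 0 := by
    linear_combination (norm := noncomm_ring) star y * hQy + hyQ * star y
  have hGQ : G * Q = Q + y := by
    rw [hG]
    linear_combination (norm := noncomm_ring) -hYQ - hyQ
  have hGQ' : G * (1 - Q) = 1 - Q - star y := by
    rw [hG]
    linear_combination (norm := noncomm_ring) hYQ + hyQ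
  have horth : star (G * Q) * (G * (1 - Q)) = 0 := by
    rw [hGQ, hGQ', star_add, hQ.isSelfAdjoint.star_eq]
    linear_combination (norm := noncomm_ring) -hQi + hQy - hyQ - hyy
  refine ⟨T₀.ker.map G.toLinearMap, inferInstance, ?_, ?_⟩
  · ext u
    have hmem : (G * Q * W) u ∈ T₀.ker.map G.toLinearMap :=
      ⟨Q (W u), Submodule.starProjection_apply_mem T₀.ker _, rfl⟩
    refine (Submodule.eq_starProjection_of_mem_orthogonal hmem ?_).symm
    rw [Submodule.mem_orthogonal]
    rintro _ ⟨x, hx, rfl⟩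
    have hx' : Q x = x := Submodule.starProjection_eq_self_iff.2 hx
    have e1 : u - (G * Q * W) u = (G * (1 - Q)) (W u) := by
      have : u = (G * W) u := by rw [hGW]; rfl
      conv_lhs => enter [1]; rw [this]
      simp [mul_sub]
    rw [e1]
    have e2 : (G : H →ₗ[ℝ] H) x = (G * Q) x := by
      change G x = G (Q x)
      rw [hx']
    rw [e2, ← ContinuousLinearMap.adjoint_inner_right]
    have e3 : (ContinuousLinearMap.adjoint (G * Q)) ((G * (1 - Q)) (W u)) = 0 :=
      congrArg (fun A : H →L[ℝ] H => A (W u)) horth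
    rw [e3, inner_zero_right]
  · rintro _ ⟨x, hx, rfl⟩
    have hx' : Q x = x := Submodule.starProjection_eq_self_iff.2 hx
    have e1 : T * (G * Q) = G * Q * (T * (Q + y)) := by
      rw [hGQ]
      have h3 : y * Q = y := by linear_combination (norm := noncomm_ring) -hYQ
      linear_combination (norm := noncomm_ring) hR + h3 * T * (Q + y)
    refine ⟨Q (T ((Q + y) x)), Submodule.starProjection_apply_mem T₀.ker _, ?_⟩
    have e2 := congrArg (fun A : H →L[ℝ] H => A x) e1
    change T (G (Q x)) = G (Q (T ((Q + y) x))) at e2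
    rw [hx'] at e2
    exact e2.symm

theorem norm_le_of_form_le {T : H →L[ℝ] H} (hT : IsSelfAdjoint T) {a : ℝ} (ha : 0 < a)
    {M : Submodule ℝ H} (h1 : ∀ x ∈ M, T x ∈ M)
    (h2 : ∀ x ∈ M, -a * ‖x‖ ^ 2 ≤ inner ℝ (T x) x ∧ inner ℝ (T x) x ≤ a * ‖x‖ ^ 2) {x : H}
    (hx : x ∈ M) : ‖T x‖ ≤ a * ‖x‖ := by
  -- Polarisation: comparing the form at `x + y` and `x - y` bounds `⟪T x, y⟫ = a⁻¹ ‖T x‖ ^ 2`.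
  set y := a⁻¹ • T x with hy
  have hyM : y ∈ M := M.smul_mem _ (h1 x hx)
  have e1 := (h2 _ (M.add_mem hx hyM)).2
  have e2 := (h2 _ (M.sub_mem hx hyM)).1
  have e3 : inner ℝ (T y) x = inner ℝ (T x) y := by
    rw [inner_selfAdjoint hT, real_inner_comm]
  have e4 := parallelogram_law_with_norm ℝ x y
  have e5 : inner ℝ (T x) y = a⁻¹ * ‖T x‖ ^ 2 := by
    rw [hy, inner_smul_right, real_inner_self_eq_norm_sq]
  have e6 : ‖y‖ = a⁻¹ * ‖T x‖ := by
    rw [hy, norm_smul, Real.norm_of_nonneg (by positivity)]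
  simp only [map_add, map_sub, inner_add_left, inner_add_right, inner_sub_left,
    inner_sub_right, e3] at e1 e2
  have e7 : 4 * (a⁻¹ * ‖T x‖ ^ 2) ≤ a * (2 * (‖x‖ ^ 2 + (a⁻¹ * ‖T x‖) ^ 2)) := by
    rw [← e6, ← e5]
    nlinarith
  have e8 : ‖T x‖ ^ 2 ≤ (a * ‖x‖) ^ 2 := by
    have : a * (2 * (‖x‖ ^ 2 + (a⁻¹ * ‖T x‖) ^ 2)) = 2 * a * ‖x‖ ^ 2 + 2 * (a⁻¹ * ‖T x‖ ^ 2) := by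
      field_simp
    rw [this] at e7
    have e9 : a⁻¹ * ‖T x‖ ^ 2 ≤ a * ‖x‖ ^ 2 := by linarith
    rw [inv_mul_le_iff₀ ha] at e9
    nlinarith
  exact (pow_le_pow_iff_left₀ (norm_nonneg _) (by positivity) two_ne_zero).1 e8

/-- On an admissible `M`, `T` stretches by at most `a`, but it stretches components in `Fᗮ` by at
least `2 a`. Iterating gives `2 ^ n * ‖x - F.starProjection x‖ ≤ ‖x‖` for all `n`, so `M ≤ F`. -/
theorem spectralSubspace_eq_of_gap {T : H →L[ℝ] H} (hT : IsSelfAdjoint T) {a : ℝ} (ha : 0 < a)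
    {F : Submodule ℝ H} [FiniteDimensional ℝ F] (hF : ∀ x ∈ F, T x ∈ F)
    (h1 : ∀ x ∈ F, ‖T x‖ ≤ a * ‖x‖) (h2 : ∀ x ∈ Fᗮ, 2 * a * ‖x‖ ≤ ‖T x‖) :
    spectralSubspace T (-a) a = F := by
  refine le_antisymm (spectralSubspace_le F.closed_of_finiteDimensional fun M hM hMa => ?_)
    (le_spectralSubspace hF fun x hx => ?_)
  · have hcomm := (commute_starProjection hT hF).eq
    have key : ∀ n : ℕ, ∀ x ∈ M, 2 ^ n * ‖x - F.starProjection x‖ ≤ ‖x‖ := by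
      intro n
      induction n with
      | zero =>
        intro x _
        rw [pow_zero, one_mul, ← Submodule.starProjection_orthogonal_val]
        exact Fᗮ.norm_starProjection_apply_le x
      | succ n ih =>
        intro x hx
        have e1 := h2 _ (Submodule.sub_starProjection_mem_orthogonal (K := F) x)
        have e2 : T (x - F.starProjection x) = T x - F.starProjection (T x) := by
          rw [map_sub, ← mul_apply_eq_comp, ← hcomm, mul_apply_eq_comp]
        rw [e2] at e1
        have e3 := ih _ (hM x hx)
        have e4 := norm_le_of_form_le hT ha hM hMa hx
        have e5 : a * (2 ^ (n + 1) * ‖x - F.starProjection x‖) ≤ a * ‖x‖ := by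
          calc a * (2 ^ (n + 1) * ‖x - F.starProjection x‖)
              = 2 ^ n * (2 * a * ‖x - F.starProjection x‖) := by ring
            _ ≤ 2 ^ n * ‖T x - F.starProjection (T x)‖ := by gcongr
            _ ≤ a * ‖x‖ := e3.trans e4
        exact le_of_mul_le_mul_left e5 ha
    intro x hx
    rw [← Submodule.starProjection_eq_self_iff]
    by_contra hne
    have hpos : 0 < ‖x - F.starProjection x‖ :=
      norm_pos_iff.2 (sub_ne_zero.2 (Ne.symm hne))
    obtain ⟨n, hn⟩ := pow_unbounded_of_one_lt (‖x‖ / ‖x - F.starProjection x‖) one_lt_two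
    rw [div_lt_iff₀ hpos] at hn
    exact absurd (key n x hx) (not_le.2 hn)
  · have e1 := abs_real_inner_le_norm (T x) x
    have e2 : ‖T x‖ * ‖x‖ ≤ a * ‖x‖ ^ 2 := by
      rw [pow_two, ← mul_assoc]
      exact mul_le_mul_of_nonneg_right (h1 x hx) (norm_nonneg _)
    have e3 := abs_le.1 (e1.trans e2)
    exact ⟨by linarith [e3.1], e3.2⟩

theorem exists_continuous_spectralProjection {T₀ : H →L[ℝ] H}
    (hT₀ : T₀ ∈ fredholmSelfAdjoint H) :
    ∃ a > 0, ∃ V : Set (H →L[ℝ] H), IsOpen V ∧ T₀ ∈ V ∧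
      (∀ T ∈ V, IsSelfAdjoint T → FiniteDimensional ℝ (spectralSubspace T (-a) a)) ∧
      ContinuousOn (fun T => spectralProjection T (-a) a) (V ∩ {T | IsSelfAdjoint T}) := by
  have := hT₀.2.finite_ker
  obtain ⟨P, hP0, hP⟩ := eventually_exists_invariant_subspace hT₀
  obtain ⟨c, hc, hcb⟩ := exists_pos_norm_le (isUnit_add_starProjection_ker hT₀)
  have hPc := hP.self_of_nhds.1
  have ev1 : ∀ᶠ T in 𝓝 T₀, ‖T * P T‖ < c / 4 := by
    have : ContinuousAt (fun T => ‖T * P T‖) T₀ := (continuousAt_id.mul hPc).norm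
    refine this.eventually (gt_mem_nhds ?_)
    have h0 : T₀ * P T₀ = 0 := by
      rw [hP0]
      ext x
      exact Submodule.starProjection_apply_mem T₀.ker x
    change ‖T₀ * P T₀‖ < c / 4
    rw [h0, norm_zero]; positivity
  have ev2 : ∀ᶠ T in 𝓝 T₀, ‖T + P T - (T₀ + T₀.ker.starProjection)‖ < c / 2 := by
    have : ContinuousAt (fun T => ‖T + P T - (T₀ + T₀.ker.starProjection)‖) T₀ :=
      ((continuousAt_id.add hPc).sub continuousAt_const).norm
    refine this.eventually (gt_mem_nhds ?_)
    change ‖T₀ + P T₀ - (T₀ + T₀.ker.starProjection)‖ < c / 2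
    rw [hP0, sub_self, norm_zero]; positivity
  -- Take `a = c / 4`: near `T₀` the operator is bounded by `c / 4` on the invariant subspace, and
  -- from below by `c - c / 2 = 2 a` on its complement.
  obtain ⟨V, hV, hVo, hTV⟩ := eventually_nhds_iff.1 (hP.and (ev1.and ev2))
  have key : ∀ T ∈ V, IsSelfAdjoint T → FiniteDimensional ℝ (spectralSubspace T (-(c / 4)) (c / 4))
      ∧ spectralProjection T (-(c / 4)) (c / 4) = P T := by
    intro T hT hsa
    obtain ⟨⟨-, F, hF, hPF, hinv⟩, h1, h2⟩ := hV T hT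
    have heq : spectralSubspace T (-(c / 4)) (c / 4) = F := by
      refine spectralSubspace_eq_of_gap hsa (by positivity) hinv (fun x hx => ?_) fun x hx => ?_
      · have e1 : (T * P T) x = T x := by
          rw [mul_apply_eq_comp, hPF, Submodule.starProjection_eq_self_iff.2 hx]
        rw [← e1]
        exact ((T * P T).le_opNorm x).trans
          (mul_le_mul_of_nonneg_right h1.le (norm_nonneg _))
      · have e1 : P T x = 0 := by
          rw [hPF]; exact (Submodule.starProjection_apply_eq_zero_iff _).2 hx
        have e2 := (T + P T - (T₀ + T₀.ker.starProjection)).le_opNorm x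
        have e3 := hcb x
        have e4 : (T₀ + T₀.ker.starProjection) x
            = T x - (T + P T - (T₀ + T₀.ker.starProjection)) x := by
          simp [e1]
        have e5 := norm_sub_le (T x) ((T + P T - (T₀ + T₀.ker.starProjection)) x)
        rw [← e4] at e5
        have e6 := mul_le_mul_of_nonneg_right h2.le (norm_nonneg x)
        linarith
    constructor
    · rw [heq]; exact hF
    · rw [hPF]
      unfold spectralProjection
      congr!
  refine ⟨c / 4, by positivity, V, hVo, hTV, fun T hT hsa => (key T hT hsa).1, ?_⟩
  have hPcont : ContinuousOn P (V ∩ {T | IsSelfAdjoint T}) := fun T hT =>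
    (hV T hT.1).1.1.continuousWithinAt
  exact hPcont.congr fun T hT => (key T hT.1 hT.2).2

theorem nonempty_spectralPartition (L : FredholmPath H) : Nonempty (SpectralPartition L) := by
  have hloc := fun s => exists_continuous_spectralProjection (L.mem_fredholmSelfAdjoint s)
  choose a ha V hVo hV hfin hcont using hloc
  obtain ⟨δ, hδ, hcov⟩ := lebesgue_number_lemma_of_metric (isCompact_univ (X := unitInterval))
    (fun s => (hVo s).preimage L.continuous_toFun)
    (fun s _ => Set.mem_iUnion.2 ⟨s, hV s⟩)
  obtain ⟨n, hn⟩ := exists_nat_one_div_lt hδ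
  have hn0 : (0 : ℝ) < n + 1 := by positivity
  let t : Fin (n + 1 + 1) → unitInterval := fun i =>
    ⟨(i : ℝ) / (n + 1), by positivity, by
      rw [div_le_one hn0]
      exact_mod_cast Nat.lt_succ_iff.1 i.2⟩
  have hcover : ∀ i : Fin (n + 1), ∃ s, Set.Icc (t i.castSucc) (t i.succ) ⊆ L ⁻¹' V s := by
    intro i
    obtain ⟨s, hs⟩ := hcov (t i.castSucc) trivial
    refine ⟨s, fun y hy => hs ?_⟩
    have h1 : (i : ℝ) / (n + 1) ≤ y := hy.1
    have h2 : (y : ℝ) ≤ ((i : ℕ) + 1 : ℕ) / ((n : ℝ) + 1) := hy.2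
    have h3 : (((i : ℕ) + 1 : ℕ) : ℝ) / ((n : ℝ) + 1) = (i : ℝ) / (n + 1) + 1 / (n + 1) := by
      push_cast; ring
    rw [Metric.mem_ball, Subtype.dist_eq, Real.dist_eq]
    change |(y : ℝ) - (i : ℝ) / (n + 1)| < δ
    rw [abs_of_nonneg (by linarith)]
    linarith
  choose r hr using hcover
  exact ⟨{
    N := n + 1
    t := t
    strictMono_t := fun i j hij => by
      change (i : ℝ) / (n + 1) < (j : ℝ) / (n + 1)
      gcongr
      exact_mod_cast hij
    t_zero := by ext; simp [t]
    t_last := by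
      ext
      simp only [t, Fin.val_last]
      push_cast
      exact div_self hn0.ne'
    a := fun i => a (r i)
    a_pos := fun i => ha _
    finite_rank := fun i s hs => hfin _ _ (hr i hs) (L.mem_fredholmSelfAdjoint s).1
    continuousOn_projection := fun i =>
      (hcont (r i)).comp L.continuous_toFun.continuousOn fun s hs =>
        ⟨hr i hs, (L.mem_fredholmSelfAdjoint s).1⟩ }⟩

end InvariantSubspace

end SpectralFlow

/-- The first two conjuncts say that the spectral flow of `L` is well defined: admissible partition
data exist, and the value does not depend on their choice. -/
theorem corollary2p2 (μ : SpectralFlow.PathInvariant.{u})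
    (hZ : SpectralFlow.ZeroProperty μ) (hA : SpectralFlow.AdditivityProperty μ)
    (hH : SpectralFlow.HomotopyProperty μ) (hM : SpectralFlow.MorseProperty μ)
    (H : Type u) [NormedAddCommGroup H] [InnerProductSpace ℝ H] [CompleteSpace H]
    [TopologicalSpace.SeparableSpace H] (L : SpectralFlow.FredholmPath H) :
    Nonempty (SpectralFlow.SpectralPartition L) ∧
      (∀ D : SpectralFlow.SpectralPartition L, D.value = SpectralFlow.spectralFlow L) ∧
      μ H L = SpectralFlow.spectralFlow L := by
  have hne := SpectralFlow.nonempty_spectralPartition L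
  have hval := SpectralFlow.invariant_eq_value hZ hA hH hM L
  have hflow : μ H L = SpectralFlow.spectralFlow L := by
    rw [SpectralFlow.spectralFlow, dif_pos hne]
    exact hval _
  -- The value is independent of `D` because each value equals `μ H L`.
  exact ⟨hne, fun D => (hval D).symm.trans hflow, hflow⟩
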